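/- Let $(\mathcal M,\mathfrak g)$ be a smooth Riemannian manifold of dimension $d\ge 1$ (Hausdorff, second countable) whose exponential map $\mathrm{Exp}_x$ is defined on all of $T_x\mathcal M$ for every $x$ (geodesic completeness). Let $n\ge1$, $f_1,\dots,f_n:\mathcal M\to\mathbb R$ and $f=\frac1n\sum_{i=1}^n f_i$. Assume that each $f_i$ is differentiable and geodesically $L$-smooth with $L>0$: for every geodesic $\gamma$ from $x=\gamma(0)$ to $y=\gamma(1)$, $\|\nabla f_i(x)-\Gamma_y^x\nabla f_i(y)\|\le L\|\gamma'(0)\|$, where $\Gamma_y^x$ is parallel transport along $\gamma$ and $\gamma'(0)=\mathrm{Exp}_x^{-1}(y)$. Assume $f\ge f^*$ on $\mathcal M$ for some $f^*\in\mathbb R$, let $x^0\in\mathcal M$ and $\delta^0=f(x^0)-f^*$. Let $\mathcal Q_1,\dots,\mathcal Q_n$ be (measurable) stochastic maps, each sending $y\in T_x\mathcal M$ to a random vector of $T_x\mathcal M$, with $\mathbb E[\mathcal Q_i(y)]=y$ and $\mathbb E\|\mathcal Q_i(y)-y\|^2\le\omega\|y\|^2$ for all $x\in\mathcal M$, $y\in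 T_x\mathcal M$, where $\omega\ge0$. Fix a (measurable) choice of a basis of every tangent space, let $\|z\|_0$ be the number of nonzero components of $z$ in this basis, and let $\rho_{\mathcal Q}=\sup_{i,x,\,y\in T_x\mathcal M}\mathbb E\|\mathcal Q_i(y)\|_0$ be the expected density. R-MARINA with stepsize $\eta$ and probability $p$ starts from $x^0$ with $g_i^0=\nabla f_i(x^0)$. In each round $k=0,1,\dots,K-1$, with $g^k=\frac1n\sum_i g_i^k$, it sets $x^{k+1}=\mathrm{Exp}_{x^k}(-\eta g^k)$ and flips one coin that is common to all workers; with probability $p$ every worker $i$ sends $\nabla f_i(x^{k+1})$ and $g_i^{k+1}=\nabla f_i(x^{k+1})$; otherwise every worker $i$ sends $\mathcal Q_i(\Delta_i^k)$ with $\Delta_i^k=\nabla f_i(x^{k+1})-\Gamma_{x^k}^{x^{k+1}}\nabla f_i(x^k)$, and $g_i^{k+1}=\Gamma_{x^k}^{x^{k+1}}g_i^k+\mathcal Q_i(\Delta_i^k)$. Here $\Gamma_{x^k}^{x^{k+1}}$ is parallel transport along the geodesic $t\mapsto\mathrm{Exp}_{x^k}(-t\eta g^k)$, and the coins and the randomness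 of the compressors are independent over all rounds and workers. Let $\widehat x^K$ be chosen uniformly at random from $x^0,\dots,x^{K-1}$, independently of the run. The communication cost of a worker is the number of components it sends: $d$ for a full gradient (in particular for $\nabla f_i(x^0)$ at the start), and $\|\mathcal Q_i(\Delta_i^k)\|_0$ for a compressed difference. Take $p=\rho_{\mathcal Q}/d$ and $\eta=\dfrac{1}{L\left(1+\sqrt{\frac{1-p}{p}\frac{\omega}{n}}\right)}$. Then there is an absolute constant $C>0$ (independent of all the data above) such that, for every $\varepsilon>0$: 1. there is an integer $K_0\ge1$ with $$K_0\le\max\left\{1,\;C\,\frac{\delta^0L}{\varepsilon^2}\left(1+\sqrt{\frac{\omega}{n}\left(\frac{d}{\rho_{\mathcal Q}}-1\right)}\right)\right\}$$ such that $\mathbb E\|\nabla f(\widehat x^K)\|^2\le\varepsilon^2$ for all $K\ge K_0$; that is, the communication complexity is $\mathcal O\left(\frac{\delta^0L}{\varepsilon^2}\left(1+\sqrt{\frac{\omega}{n}\left(\frac{d}{\rho_{\mathcal Q}}-1\right)}\right)\right)$; 2. for every $K$ and every worker, the expected total communication cost of $K$ rounds is at most $C(d+\rho_{\mathcal Q}K)$.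 -/

import Mathlib

open Bundle Manifold MeasureTheory ProbabilityTheory
open scoped ContDiff ENNReal Manifold

noncomputable section

namespace RMarina

section Geometry

variable {d : ℕ} {M : Type*} [TopologicalSpace M]
  [ChartedSpace (EuclideanSpace ℝ (Fin d)) M] [IsManifold (𝓡 d) ∞ M]

/-- The velocity `γ'(t)` of a curve in `M`. -/
def velocity (γ : ℝ → M) (t : ℝ) : TangentSpace (𝓡 d) (γ t) :=
  mfderiv 𝓘(ℝ, ℝ) (𝓡 d) γ t (1 : ℝ)

/-- The coordinates `dφ_q(v)` of a tangent vector `v` at `q`, for the chart `φ` around `p` (`q` in its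
domain). -/
def toCoord (p q : M) (v : TangentSpace (𝓡 d) q) : EuclideanSpace ℝ (Fin d) :=
  (trivializationAt (EuclideanSpace ℝ (Fin d)) (TangentSpace (𝓡 d) : M → Type _) p).continuousLinearMapAt
    ℝ q v

/-- The tangent vector at `q` with coordinates `u` in the chart around `p`, the inverse of
`toCoord`. -/
def ofCoord (p q : M) (u : EuclideanSpace ℝ (Fin d)) : TangentSpace (𝓡 d) q :=
  (trivializationAt (EuclideanSpace ℝ (Fin d)) (TangentSpace (𝓡 d) : M → Type _) p).symmL ℝ q u

variable [RiemannianBundle (fun x : M => TangentSpace (𝓡 d) x)]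

/-- The Riemannian metric in the chart `φ` around `p`: `G(y)(u, w)` is the inner product of the tangent
vectors at `φ⁻¹(y)` with coordinates `u` and `w`. -/
def chartMetric (p : M) (y u w : EuclideanSpace ℝ (Fin d)) : ℝ :=
  inner ℝ (ofCoord p ((extChartAt (𝓡 d) p).symm y) u) (ofCoord p ((extChartAt (𝓡 d) p).symm y) w)

/-- The Christoffel symbols of the first kind of the Levi-Civita connection in the chart around `p`,
that is `G(∇_u w, z)` for constant coordinate fields `u`, `w`, `z`. -/
def christoffel (p : M) (y u w z : EuclideanSpace ℝ (Fin d)) : ℝ :=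
  (fderiv ℝ (fun y' => chartMetric p y' w z) y u
    + fderiv ℝ (fun y' => chartMetric p y' u z) y w
    - fderiv ℝ (fun y' => chartMetric p y' u w) y z) / 2

/-- The vector field `V` along the curve `γ` is parallel for the Levi-Civita connection: at each time
`t`, in the chart `φ` around `γ t`, with `c = φ ∘ γ` and `v = dφ(V)`, the covariant derivative
`v' + Γ(c', v)` vanishes. The equation is written with the index lowered by the metric, i.e. tested
against every `z`. -/
def IsParallelAlong (γ : ℝ → M) (V : ∀ t, TangentSpace (𝓡 d) (γ t)) : Prop :=
  ∀ t, MDifferentiableAt 𝓘(ℝ, ℝ) (𝓡 d) γ t ∧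
    ∃ v' : EuclideanSpace ℝ (Fin d),
      HasDerivAt (fun s => toCoord (γ t) (γ s) (V s)) v' t ∧
      ∀ z : EuclideanSpace ℝ (Fin d),
        chartMetric (γ t) (extChartAt (𝓡 d) (γ t) (γ t)) v' z
          + christoffel (γ t) (extChartAt (𝓡 d) (γ t) (γ t))
              (deriv (fun s => extChartAt (𝓡 d) (γ t) (γ s)) t)
              (toCoord (γ t) (γ t) (V t)) z = 0

/-- Geodesics: the velocity is parallel along the curve. -/
def IsGeodesic (γ : ℝ → M) : Prop :=
  IsParallelAlong (d := d) γ (velocity γ)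

variable (d M) in
/-- Every tangent vector is the initial velocity of a geodesic defined for all times, i.e. the
exponential map is defined on the whole tangent bundle. -/
def GeodesicallyComplete : Prop :=
  ∀ (x : M) (v : TangentSpace (𝓡 d) x), ∃ γ : ℝ → M, IsGeodesic (d := d) γ ∧
    (⟨γ 0, velocity γ 0⟩ : TangentBundle (𝓡 d) M) = ⟨x, v⟩

open Classical in
/-- The geodesic `t ↦ Exp_x(t v)` (the constant curve if there is none). -/
def geodesic (x : M) (v : TangentSpace (𝓡 d) x) : ℝ → M :=
  if h : ∃ γ : ℝ → M, IsGeodesic (d := d) γ ∧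
      (⟨γ 0, velocity γ 0⟩ : TangentBundle (𝓡 d) M) = ⟨x, v⟩
  then h.choose else fun _ => x

/-- The exponential map `Exp_x(v)`. -/
def riemExp (x : M) (v : TangentSpace (𝓡 d) x) : M := geodesic x v 1

open Classical in
/-- Parallel transport along `γ` from time `a` to time `b` of the tangent vector `u` at `γ a`. -/
def parallelTransport (γ : ℝ → M) (a b : ℝ) (u : TangentBundle (𝓡 d) M) :
    TangentSpace (𝓡 d) (γ b) :=
  if h : ∃ V : ∀ t, TangentSpace (𝓡 d) (γ t), IsParallelAlong γ V ∧
      (⟨γ a, V a⟩ : TangentBundle (𝓡 d) M) = u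
  then h.choose b else 0

/-- Parallel transport `T_x M → T_y M`, `y = Exp_x(v)`, along the geodesic `t ↦ Exp_x(t v)`. -/
def expTransport (x : M) (v u : TangentSpace (𝓡 d) x) : TangentSpace (𝓡 d) (riemExp x v) :=
  parallelTransport (geodesic x v) 0 1 ⟨x, u⟩

/-- The Riemannian gradient of `f` at `x`: the tangent vector representing `df(x)`. -/
def riemGrad (f : M → ℝ) (x : M) : TangentSpace (𝓡 d) x :=
  haveI : FiniteDimensional ℝ (TangentSpace (𝓡 d) x) :=
    inferInstanceAs (FiniteDimensional ℝ (EuclideanSpace ℝ (Fin d)))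
  haveI : CompleteSpace (TangentSpace (𝓡 d) x) :=
    FiniteDimensional.complete ℝ (TangentSpace (𝓡 d) x)
  (InnerProductSpace.toDual ℝ (TangentSpace (𝓡 d) x)).symm (mvfderiv (𝓡 d) f x)

variable (d) in
/-- Geodesic `L`-smoothness: `f` is differentiable and, for every geodesic `γ` from `x = γ 0` to
`y = γ 1`, `‖∇f(x) - Γ_y^x ∇f(y)‖ ≤ L ‖γ'(0)‖`, where `Γ_y^x` is the parallel transport along `γ`
and `γ'(0) = Exp_x⁻¹(y)`. -/
def IsGSmooth (L : ℝ) (f : M → ℝ) : Prop :=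
  MDifferentiable (𝓡 d) 𝓘(ℝ, ℝ) f ∧
  ∀ γ : ℝ → M, IsGeodesic (d := d) γ →
    ‖riemGrad (d := d) f (γ 0)
        - parallelTransport γ 1 0 ⟨γ 1, riemGrad (d := d) f (γ 1)⟩‖
      ≤ L * ‖velocity (d := d) γ 0‖

end Geometry

section Compression

variable {d : ℕ} {M : Type*} [TopologicalSpace M]
  [ChartedSpace (EuclideanSpace ℝ (Fin d)) M] [IsManifold (𝓡 d) ∞ M]
  {S : Type*} [MeasurableSpace S]

variable (d) in
/-- A Borel measurable frame of the tangent bundle: a basis of every tangent space. The components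
of a tangent vector are its coordinates in this basis. -/
structure MeasurableFrame (M : Type*) [TopologicalSpace M]
    [ChartedSpace (EuclideanSpace ℝ (Fin d)) M] [IsManifold (𝓡 d) ∞ M] where
  basis : ∀ x : M, Module.Basis (Fin d) ℝ (TangentSpace (𝓡 d) x)
  measurable : ∀ j : Fin d, @Measurable M (TangentBundle (𝓡 d) M) (borel _) (borel _)
    (fun x => ⟨x, basis x j⟩)

/-- `‖z‖₀`, the number of nonzero components of `z`. -/
def MeasurableFrame.nnz (b : MeasurableFrame d M) {x : M} (z : TangentSpace (𝓡 d) x) : ℕ :=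
  ((b.basis x).repr z).support.card

/-- `q s x y` is the value on `y ∈ T_x M` of a stochastic map with random seed `s ∼ ν`. It is an
unbiased compressor with conic variance `ωQ`. -/
structure IsUnbiasedCompressor [RiemannianBundle (fun x : M => TangentSpace (𝓡 d) x)]
    (ν : Measure S) (ωQ : ℝ)
    (q : S → ∀ x : M, TangentSpace (𝓡 d) x → TangentSpace (𝓡 d) x) : Prop where
  nonneg : 0 ≤ ωQ
  measurable : @Measurable (S × TangentBundle (𝓡 d) M) (TangentBundle (𝓡 d) M)
    (@Prod.instMeasurableSpace _ _ _ (borel _)) (borel _)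
    (fun z => ⟨z.2.proj, q z.1 z.2.proj z.2.snd⟩)
  unbiased : ∀ (x : M) (y : TangentSpace (𝓡 d) x), ∫ s, q s x y ∂ν = y
  variance : ∀ (x : M) (y : TangentSpace (𝓡 d) x),
    ∫⁻ s, ‖q s x y - y‖ₑ ^ 2 ∂ν ≤ ENNReal.ofReal (ωQ * ‖y‖ ^ 2)

/-- The expected density `ρ_Q`: the supremum of `𝔼 ‖Q_i(y)‖₀` over all workers `i`, points `x` and
`y ∈ T_x M`. -/
def expectedDensity {n : ℕ} (b : MeasurableFrame d M) (ν : Measure S)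
    (Q : Fin n → S → ∀ x : M, TangentSpace (𝓡 d) x → TangentSpace (𝓡 d) x) : ℝ :=
  (⨆ (i : Fin n) (x : M) (y : TangentSpace (𝓡 d) x),
    ∫⁻ s, (b.nnz (Q i s x y) : ℝ≥0∞) ∂ν).toReal

end Compression

section Algorithm

variable {d : ℕ} {M : Type*} [TopologicalSpace M]
  [ChartedSpace (EuclideanSpace ℝ (Fin d)) M] [IsManifold (𝓡 d) ∞ M]
  [RiemannianBundle (fun x : M => TangentSpace (𝓡 d) x)]
  {S : Type*} [MeasurableSpace S] {n : ℕ}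

/-- The objective `f = (1/n) ∑ f_i`. -/
def objective (f : Fin n → M → ℝ) (x : M) : ℝ := (∑ i, f i x) / n

variable (d M n) in
/-- The state of the method: the iterate `x^k` and the estimators `g_i^k` of the workers. -/
structure State where
  point : M
  est : Fin n → TangentSpace (𝓡 d) point

/-- The step vector `-η g^k` with `g^k = (1/n) ∑ g_i^k`. -/
def State.stepVec (η : ℝ) (st : State d M n) : TangentSpace (𝓡 d) st.point :=
  -(η • ((n : ℝ)⁻¹ • ∑ i, st.est i))

/-- The next iterate `x^{k+1} = Exp_{x^k}(-η g^k)`. -/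
def State.next (η : ℝ) (st : State d M n) : M := riemExp st.point (st.stepVec η)

/-- The parallel transport `Γ_{x^k}^{x^{k+1}}` along the geodesic of the step. -/
def State.transport (η : ℝ) (st : State d M n) (u : TangentSpace (𝓡 d) st.point) :
    TangentSpace (𝓡 d) (st.next η) :=
  expTransport st.point (st.stepVec η) u

/-- The gradient difference `∇f_i(x^{k+1}) - Γ_{x^k}^{x^{k+1}} ∇f_i(x^k)` of worker `i`. -/
def State.gradDiff (f : Fin n → M → ℝ) (η : ℝ) (st : State d M n) (i : Fin n) :
    TangentSpace (𝓡 d) (st.next η) :=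
  riemGrad (f i) (st.next η) - st.transport η (riemGrad (f i) st.point)

/-- The randomness of one round: the coin shared by all workers (`true` means that the full gradients
are sent) and the seeds of the compressors of the workers. -/
abbrev Round (S : Type*) (n : ℕ) := Bool × (Fin n → S)

/-- One round of R-MARINA. -/
def step (f : Fin n → M → ℝ)
    (Q : Fin n → S → ∀ x : M, TangentSpace (𝓡 d) x → TangentSpace (𝓡 d) x)
    (η : ℝ) (st : State d M n) (r : Round S n) : State d M n where
  point := st.next η
  est i :=
    if r.1 then riemGrad (f i) (st.next η)
    else st.transport η (st.est i) + Q i (r.2 i) (st.next η) (st.gradDiff f η i)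

/-- The state after `k` rounds, started at `x⁰` with `g_i^0 = ∇f_i(x⁰)`. -/
def iter (f : Fin n → M → ℝ)
    (Q : Fin n → S → ∀ x : M, TangentSpace (𝓡 d) x → TangentSpace (𝓡 d) x)
    (η : ℝ) (x0 : M) : (k : ℕ) → (Fin k → Round S n) → State d M n
  | 0, _ => ⟨x0, fun i => riemGrad (f i) x0⟩
  | k + 1, r => step f Q η (iter f Q η x0 k (Fin.init r)) (r (Fin.last k))

/-- The state `(x^k, g_i^k)` in a run of `K` rounds with randomness `r`, for `k ≤ K`. -/
def iterOf (f : Fin n → M → ℝ)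
    (Q : Fin n → S → ∀ x : M, TangentSpace (𝓡 d) x → TangentSpace (𝓡 d) x)
    (η : ℝ) (x0 : M) {K : ℕ} (r : Fin K → Round S n) (k : Fin (K + 1)) : State d M n :=
  iter f Q η x0 k (fun j => r (Fin.castLE k.is_le j))

/-- The law of the randomness of a run of `K` rounds: all coins are Bernoulli(`p`), all seeds have
law `ν`, and all of them are independent. -/
def runLaw (p : unitInterval) (ν : Measure S) (n K : ℕ) : Measure (Fin K → Round S n) :=
  Measure.pi fun _ => (bernoulliMeasure true false p).prod (Measure.pi fun _ => ν)

/-- `𝔼 ‖∇f(x̂^K)‖²`, where `x̂^K` is chosen from `x⁰, …, x^{K-1}` uniformly at random and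
independently of the run. -/
def expectedSqGrad (f : Fin n → M → ℝ)
    (Q : Fin n → S → ∀ x : M, TangentSpace (𝓡 d) x → TangentSpace (𝓡 d) x)
    (η : ℝ) (x0 : M) (p : unitInterval) (ν : Measure S) (K : ℕ) : ℝ≥0∞ :=
  ∫⁻ z, ‖riemGrad (d := d) (objective f) (iterOf f Q η x0 z.1 z.2.castSucc).point‖ₑ ^ 2
    ∂((runLaw p ν n K).prod (uniformOn (Set.univ : Set (Fin K))))

/-- The number of components that worker `i` sends in a run of `K` rounds: the `d` components of
`∇f_i(x⁰)`, and in each round either the `d` components of `∇f_i(x^{k+1})` or the nonzero components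
of the compressed gradient difference. -/
def commCost (b : MeasurableFrame d M) (f : Fin n → M → ℝ)
    (Q : Fin n → S → ∀ x : M, TangentSpace (𝓡 d) x → TangentSpace (𝓡 d) x)
    (η : ℝ) (x0 : M) (i : Fin n) {K : ℕ} (r : Fin K → Round S n) : ℕ :=
  d + ∑ k : Fin K,
    if (r k).1 then d
    else b.nnz (Q i ((r k).2 i) _ ((iterOf f Q η x0 r k.castSucc).gradDiff f η i))

end Algorithm

end RMarina

end

/-! The proof follows a Lyapunov function. Write `g` for the averaged estimator at `x` and `e = g -
∇f(x)` for its error; the potential is `(2/η)(f(x) - f*) + (1/p)‖e‖²`.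

Error: a full round resets `e` to zero. In a compressed round the new error is the parallel
transport of `e`, of the same norm, plus the average of `n` independent centred compression errors.
Geodesic smoothness bounds each gradient difference by `Lη‖g‖`, so the expected squared error after
a round is at most `(1-p)(‖e‖² + (ω/n)(Lη‖g‖)²)` (`lintegral_err_step_le`).

Descent: along the geodesic of the step, `f` rises by at most `-η⟨∇f, g⟩ + (L/2)η²‖g‖²`
(`IsGSmooth.descent`, averaged in `objective_next_le`). Expanding `‖g - ∇f‖²` makes everything
cancel except `‖∇f‖²` and a multiple of `‖g‖²`, whose coefficient has the right sign for the given
stepsize (`potential_arith`). Telescoping gives an average of `𝔼‖∇f(x^k)‖²` of at most `2δ⁰/(ηK)`,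
since the initial error vanishes. For the cost, a round sends in expectation at most `pd + (1-p)ρ ≤
2ρ` components.

Two points need work beyond this. Parallel transport is a choice of a solution of an equation
written at each time in another chart, so existence, uniqueness, linearity and isometry must be
proved: chart independence (`IsParallelIn.change`), metric compatibility (`christoffel_add_swap`),
linear differential equations and continuation (`IsGeodesic.exists_parallel`). And the iterates
depend on chosen geodesics, so their measurability is not available; the expectations are lower
integrals, for which one inequality in Tonelli's theorem always holds (`lintegral_prod_le`), and it
is the one needed. -/

set_option linter.unusedSectionVars false

noncomputable section

namespace RMarina

open scoped Topology

/-! ### Tangent vectors in charts and changes of coordinates. -/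

section Coordinates

variable {d : ℕ} {M : Type*} [TopologicalSpace M]
  [ChartedSpace (EuclideanSpace ℝ (Fin d)) M] [IsManifold (𝓡 d) ∞ M]

lemma isManifold_one : IsManifold (𝓡 d) 1 M := .of_le (n := ∞) (by norm_num)

lemma toCoord_add (p q : M) (v w : TangentSpace (𝓡 d) q) :
    toCoord p q (v + w) = toCoord p q v + toCoord p q w := map_add _ _ _

lemma toCoord_smul (p q : M) (a : ℝ) (v : TangentSpace (𝓡 d) q) :
    toCoord p q (a • v) = a • toCoord p q v := map_smul _ _ _

lemma ofCoord_add (p q : M) (v w : EuclideanSpace ℝ (Fin d)) :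
    (ofCoord p q (v + w) : TangentSpace (𝓡 d) q) = ofCoord p q v + ofCoord p q w := map_add _ _ _

lemma ofCoord_smul (p q : M) (a : ℝ) (v : EuclideanSpace ℝ (Fin d)) :
    (ofCoord p q (a • v) : TangentSpace (𝓡 d) q) = a • ofCoord p q v := map_smul _ _ _

lemma ofCoord_toCoord {p q : M} (hq : q ∈ (chartAt (EuclideanSpace ℝ (Fin d)) p).source)
    (v : TangentSpace (𝓡 d) q) : ofCoord p q (toCoord p q v) = v :=
  Trivialization.symmL_continuousLinearMapAt _ hq v

lemma toCoord_ofCoord {p q : M} (hq : q ∈ (chartAt (EuclideanSpace ℝ (Fin d)) p).source)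
    (u : EuclideanSpace ℝ (Fin d)) : toCoord p q (ofCoord p q u) = u :=
  Trivialization.continuousLinearMapAt_symmL _ hq u

lemma toCoord_eq_mfderiv {p q : M} (hq : q ∈ (chartAt (EuclideanSpace ℝ (Fin d)) p).source)
    (v : TangentSpace (𝓡 d) q) :
    toCoord p q v = mfderiv (𝓡 d) 𝓘(ℝ, EuclideanSpace ℝ (Fin d)) (extChartAt (𝓡 d) p) q v := by
  have := isManifold_one (d := d) (M := M)
  rw [toCoord, TangentBundle.continuousLinearMapAt_trivializationAt hq]
  rfl

lemma toCoord_eq_tangentCoordChange {p q : M}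
    (hq : q ∈ (chartAt (EuclideanSpace ℝ (Fin d)) p).source) (v : TangentSpace (𝓡 d) q) :
    toCoord p q v = tangentCoordChange (𝓡 d) q p q v := by
  have := isManifold_one (d := d) (M := M)
  rw [toCoord, TangentBundle.continuousLinearMapAt_trivializationAt_eq_core hq]
  rfl

/-- The change of coordinates from the chart around `p` to the chart around `p'`. -/
def transition (p p' : M) : EuclideanSpace ℝ (Fin d) → EuclideanSpace ℝ (Fin d) :=
  extChartAt (𝓡 d) p' ∘ (extChartAt (𝓡 d) p).symm

lemma contDiffAt_transition {p p' q : M}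
    (hq : q ∈ (chartAt (EuclideanSpace ℝ (Fin d)) p).source)
    (hq' : q ∈ (chartAt (EuclideanSpace ℝ (Fin d)) p').source) :
    ContDiffAt ℝ ∞ (transition (d := d) p p') (extChartAt (𝓡 d) p q) := by
  have h : extChartAt (𝓡 d) p q ∈ ((extChartAt (𝓡 d) p).symm ≫ (extChartAt (𝓡 d) p')).source := by
    rw [PartialEquiv.trans_source'', PartialEquiv.symm_symm, PartialEquiv.symm_target]
    exact Set.mem_image_of_mem _ ⟨by simpa using hq, by simpa using hq'⟩
  have := contDiffWithinAt_ext_coord_change (I := 𝓡 d) (n := ∞) p' p h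
  simpa [transition, contDiffWithinAt_univ] using this

lemma toCoord_transition {p p' q : M}
    (hq : q ∈ (chartAt (EuclideanSpace ℝ (Fin d)) p).source)
    (hq' : q ∈ (chartAt (EuclideanSpace ℝ (Fin d)) p').source) (v : TangentSpace (𝓡 d) q) :
    toCoord p' q v
      = fderiv ℝ (transition (d := d) p p') (extChartAt (𝓡 d) p q) (toCoord p q v) := by
  have := isManifold_one (d := d) (M := M)
  rw [toCoord_eq_tangentCoordChange hq, toCoord_eq_tangentCoordChange hq']
  refine (tangentCoordChange_comp (I := 𝓡 d) (w := q) (x := p) (y := p') (z := q)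
    ⟨⟨by simp, by simpa using hq⟩, by simpa using hq'⟩).symm.trans ?_
  rw [tangentCoordChange_def (x := p)]
  simp [transition, fderivWithin_univ]

lemma transition_extChartAt {p p' q : M}
    (hq : q ∈ (chartAt (EuclideanSpace ℝ (Fin d)) p).source) :
    transition (d := d) p p' (extChartAt (𝓡 d) p q) = extChartAt (𝓡 d) p' q := by
  simp [transition, (chartAt (EuclideanSpace ℝ (Fin d)) p).left_inv hq]

/-- The velocity of a curve in coordinates. -/
lemma toCoord_velocity {γ : ℝ → M} {t : ℝ} {p : M}
    (hγ : MDifferentiableAt 𝓘(ℝ, ℝ) (𝓡 d) γ t)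
    (hp : γ t ∈ (chartAt (EuclideanSpace ℝ (Fin d)) p).source) :
    HasDerivAt (fun s => extChartAt (𝓡 d) p (γ s)) (toCoord p (γ t) (velocity γ t)) t := by
  have := isManifold_one (d := d) (M := M)
  have h1 : MDifferentiableAt (𝓡 d) 𝓘(ℝ, EuclideanSpace ℝ (Fin d)) (extChartAt (𝓡 d) p) (γ t) :=
    mdifferentiableAt_extChartAt hp
  have h2 := (h1.comp t hγ)
  rw [toCoord_eq_mfderiv hp, velocity]
  have h3 := mfderiv_comp t h1 hγ
  have h4 := h2.differentiableAt.hasFDerivAt.hasDerivAt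
  rw [← mfderiv_eq_fderiv, h3] at h4
  exact h4

end Coordinates

/-! ### The metric in a chart as a smooth family of bilinear forms. -/

section Metric

variable {d : ℕ} {M : Type*} [TopologicalSpace M]
  [ChartedSpace (EuclideanSpace ℝ (Fin d)) M] [IsManifold (𝓡 d) ∞ M]
  [RiemannianBundle (fun x : M => TangentSpace (𝓡 d) x)]

/-- The Riemannian metric in a chart, as a continuous bilinear form. -/
def chartForm (p : M) (y : EuclideanSpace ℝ (Fin d)) :
    EuclideanSpace ℝ (Fin d) →L[ℝ] EuclideanSpace ℝ (Fin d) →L[ℝ] ℝ :=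
  LinearMap.toContinuousLinearMap
    ((LinearMap.toContinuousLinearMap (𝕜 := ℝ) (E := EuclideanSpace ℝ (Fin d)) (F' := ℝ)).toLinearMap
      ∘ₗ LinearMap.mk₂ ℝ (chartMetric p y)
      (by intro a b c; simp only [chartMetric, ofCoord_add, inner_add_left])
      (by intro a b c; simp only [chartMetric, ofCoord_smul, real_inner_smul_left, smul_eq_mul])
      (by intro a b c; simp only [chartMetric, ofCoord_add, inner_add_right])
      (by intro a b c; simp only [chartMetric, ofCoord_smul, real_inner_smul_right, smul_eq_mul]))

lemma chartForm_apply (p : M) (y u w : EuclideanSpace ℝ (Fin d)) :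
    chartForm p y u w = chartMetric p y u w := rfl

lemma chartForm_symm (p : M) (y u w : EuclideanSpace ℝ (Fin d)) :
    chartForm p y u w = chartForm p y w u := by
  simp only [chartForm_apply, chartMetric, real_inner_comm]

lemma inner_eq_chartForm {p q : M} (hq : q ∈ (chartAt (EuclideanSpace ℝ (Fin d)) p).source)
    (v w : TangentSpace (𝓡 d) q) :
    inner ℝ v w = chartForm p (extChartAt (𝓡 d) p q) (toCoord p q v) (toCoord p q w) := by
  have h : (extChartAt (𝓡 d) p).symm (extChartAt (𝓡 d) p q) = q :=
    (extChartAt (𝓡 d) p).left_inv (by simpa using hq)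
  rw [chartForm_apply, chartMetric, h, ofCoord_toCoord hq, ofCoord_toCoord hq]

variable [IsContMDiffRiemannianBundle (𝓡 d) ∞ (EuclideanSpace ℝ (Fin d))
          (fun x : M => TangentSpace (𝓡 d) x)]

/-- A field with constant coordinates is a smooth section, because its trivialisation is constant
over the chart domain; the inner product of two smooth sections is smooth. -/
lemma contDiffAt_chartMetric {p q : M} (hq : q ∈ (chartAt (EuclideanSpace ℝ (Fin d)) p).source)
    (u w : EuclideanSpace ℝ (Fin d)) :
    ContDiffAt ℝ ∞ (fun y => chartMetric p y u w) (extChartAt (𝓡 d) p q) := by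
  have hs : (extChartAt (𝓡 d) p).symm (extChartAt (𝓡 d) p q) = q :=
    (extChartAt (𝓡 d) p).left_inv (by simpa using hq)
  have hb : ContMDiffAt 𝓘(ℝ, EuclideanSpace ℝ (Fin d)) (𝓡 d) ∞ (extChartAt (𝓡 d) p).symm
      (extChartAt (𝓡 d) p q) :=
    (contMDiffOn_extChartAt_symm p).contMDiffAt
      ((isOpen_extChartAt_target p).mem_nhds
        ((extChartAt (𝓡 d) p).map_source (by simpa using hq)))
  have key : ∀ u : EuclideanSpace ℝ (Fin d),
      ContMDiffAt 𝓘(ℝ, EuclideanSpace ℝ (Fin d)) ((𝓡 d).prod 𝓘(ℝ, EuclideanSpace ℝ (Fin d))) ∞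
        (fun y => (⟨(extChartAt (𝓡 d) p).symm y, ofCoord p ((extChartAt (𝓡 d) p).symm y) u⟩ :
          TotalSpace (EuclideanSpace ℝ (Fin d)) (fun x : M => TangentSpace (𝓡 d) x)))
        (extChartAt (𝓡 d) p q) := by
    intro u
    rw [Trivialization.contMDiffAt_iff (e := trivializationAt (EuclideanSpace ℝ (Fin d))
      (TangentSpace (𝓡 d) : M → Type _) p) (by
        simpa [(chartAt (EuclideanSpace ℝ (Fin d)) p).left_inv hq] using hq)]
    refine ⟨hb, (contMDiffAt_const (c := u)).congr_of_eventuallyEq ?_⟩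
    filter_upwards [(isOpen_extChartAt_target p).mem_nhds
        ((extChartAt (𝓡 d) p).map_source (by simpa using hq))] with y hy
    have hy' := (extChartAt (𝓡 d) p).map_target hy
    rw [extChartAt_source] at hy'
    have h2 := toCoord_ofCoord hy' u
    rw [toCoord, Trivialization.continuousLinearMapAt_apply,
      Trivialization.linearMapAt_apply] at h2
    exact (if_pos hy').symm.trans h2
  exact ((key u).inner_bundle (key w)).contDiffAt

lemma contDiffAt_chartForm {p q : M} (hq : q ∈ (chartAt (EuclideanSpace ℝ (Fin d)) p).source) :
    ContDiffAt ℝ ∞ (chartForm (d := d) p) (extChartAt (𝓡 d) p q) := by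
  have h : ContDiffOn ℝ ∞ (chartForm (d := d) p) (extChartAt (𝓡 d) p).target := by
    rw [contDiffOn_clm_apply]
    intro u
    rw [contDiffOn_clm_apply]
    intro w y hy
    have hy' := (extChartAt (𝓡 d) p).map_target hy
    rw [extChartAt_source] at hy'
    have := contDiffAt_chartMetric hy' u w
    rw [(extChartAt (𝓡 d) p).right_inv hy] at this
    exact this.contDiffWithinAt
  exact h.contDiffAt ((isOpen_extChartAt_target p).mem_nhds
        ((extChartAt (𝓡 d) p).map_source (by simpa using hq)))

end Metric

/-! Shortcut instances: in the presence of a `RiemannianBundle` instance the search for them is slow. -/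

section Instances

variable {d : ℕ}

instance instNormedAddCommGroupForm :
    NormedAddCommGroup (EuclideanSpace ℝ (Fin d) →L[ℝ] EuclideanSpace ℝ (Fin d) →L[ℝ] ℝ) :=
  ContinuousLinearMap.toNormedAddCommGroup

instance instNormedSpaceForm :
    NormedSpace ℝ (EuclideanSpace ℝ (Fin d) →L[ℝ] EuclideanSpace ℝ (Fin d) →L[ℝ] ℝ) :=
  ContinuousLinearMap.toNormedSpace

instance instNormedAddCommGroupDual : NormedAddCommGroup (EuclideanSpace ℝ (Fin d) →L[ℝ] ℝ) :=
  ContinuousLinearMap.toNormedAddCommGroup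

instance instNormedSpaceDual : NormedSpace ℝ (EuclideanSpace ℝ (Fin d) →L[ℝ] ℝ) :=
  ContinuousLinearMap.toNormedSpace

instance instAddCommGroupForm :
    AddCommGroup (EuclideanSpace ℝ (Fin d) →L[ℝ] EuclideanSpace ℝ (Fin d) →L[ℝ] ℝ) :=
  ContinuousLinearMap.addCommGroup

instance instModuleForm :
    Module ℝ (EuclideanSpace ℝ (Fin d) →L[ℝ] EuclideanSpace ℝ (Fin d) →L[ℝ] ℝ) :=
  ContinuousLinearMap.module

end Instances

/-! ### Christoffel symbols and parallel fields: chart independence and uniqueness. -/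

section Parallel

variable {d : ℕ} {M : Type*} [TopologicalSpace M]
  [ChartedSpace (EuclideanSpace ℝ (Fin d)) M] [IsManifold (𝓡 d) ∞ M]
  [RiemannianBundle (fun x : M => TangentSpace (𝓡 d) x)]
  [IsContMDiffRiemannianBundle (𝓡 d) ∞ (EuclideanSpace ℝ (Fin d))
          (fun x : M => TangentSpace (𝓡 d) x)]

lemma hasFDerivAt_chartForm {p q : M} (hq : q ∈ (chartAt (EuclideanSpace ℝ (Fin d)) p).source) :
    HasFDerivAt (chartForm (d := d) p)
      (fderiv ℝ (chartForm (d := d) p) (extChartAt (𝓡 d) p q)) (extChartAt (𝓡 d) p q) :=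
  ((contDiffAt_chartForm hq).differentiableAt (by norm_num)).hasFDerivAt

lemma fderiv_chartMetric {p q : M} (hq : q ∈ (chartAt (EuclideanSpace ℝ (Fin d)) p).source)
    (u w z : EuclideanSpace ℝ (Fin d)) :
    fderiv ℝ (fun y => chartMetric p y w z) (extChartAt (𝓡 d) p q) u
      = fderiv ℝ (chartForm (d := d) p) (extChartAt (𝓡 d) p q) u w z := by
  have h := ((hasFDerivAt_chartForm hq).clm_apply (hasFDerivAt_const w _)).clm_apply
    (hasFDerivAt_const z _)
  have h' := h.fderiv
  simp only [chartForm_apply] at h'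
  rw [h']
  simp

lemma christoffel_eq {p q : M} (hq : q ∈ (chartAt (EuclideanSpace ℝ (Fin d)) p).source)
    (u w z : EuclideanSpace ℝ (Fin d)) :
    christoffel p (extChartAt (𝓡 d) p q) u w z
      = (fderiv ℝ (chartForm (d := d) p) (extChartAt (𝓡 d) p q) u w z
        + fderiv ℝ (chartForm (d := d) p) (extChartAt (𝓡 d) p q) w u z
        - fderiv ℝ (chartForm (d := d) p) (extChartAt (𝓡 d) p q) z u w) / 2 := by
  simp only [christoffel, fderiv_chartMetric hq]

lemma fderiv_chartForm_symm {p q : M} (hq : q ∈ (chartAt (EuclideanSpace ℝ (Fin d)) p).source)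
    (u w z : EuclideanSpace ℝ (Fin d)) :
    fderiv ℝ (chartForm (d := d) p) (extChartAt (𝓡 d) p q) u w z
      = fderiv ℝ (chartForm (d := d) p) (extChartAt (𝓡 d) p q) u z w := by
  rw [← fderiv_chartMetric hq, ← fderiv_chartMetric hq]
  congr 2
  ext y
  exact chartForm_symm p y w z

/-- Metric compatibility of the Christoffel symbols. -/
lemma christoffel_add_swap {p q : M} (hq : q ∈ (chartAt (EuclideanSpace ℝ (Fin d)) p).source)
    (u w z : EuclideanSpace ℝ (Fin d)) :
    christoffel p (extChartAt (𝓡 d) p q) u w z + christoffel p (extChartAt (𝓡 d) p q) u z w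
      = fderiv ℝ (chartForm (d := d) p) (extChartAt (𝓡 d) p q) u w z := by
  rw [christoffel_eq hq, christoffel_eq hq, fderiv_chartForm_symm hq u z w]
  ring

lemma chartForm_transition {p p' q : M}
    (hq : q ∈ (chartAt (EuclideanSpace ℝ (Fin d)) p).source)
    (hq' : q ∈ (chartAt (EuclideanSpace ℝ (Fin d)) p').source)
    (u w : EuclideanSpace ℝ (Fin d)) :
    chartForm p (extChartAt (𝓡 d) p q) u w
      = chartForm p' (transition (d := d) p p' (extChartAt (𝓡 d) p q))
        (fderiv ℝ (transition (d := d) p p') (extChartAt (𝓡 d) p q) u)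
        (fderiv ℝ (transition (d := d) p p') (extChartAt (𝓡 d) p q) w) := by
  have h := inner_eq_chartForm hq' (ofCoord p q u) (ofCoord p q w)
  rw [inner_eq_chartForm hq, toCoord_ofCoord hq, toCoord_ofCoord hq, toCoord_transition hq hq',
    toCoord_transition hq hq', toCoord_ofCoord hq, toCoord_ofCoord hq] at h
  rw [h, transition_extChartAt hq]

lemma hasFDerivAt_fderiv_transition {p p' q : M}
    (hq : q ∈ (chartAt (EuclideanSpace ℝ (Fin d)) p).source)
    (hq' : q ∈ (chartAt (EuclideanSpace ℝ (Fin d)) p').source) :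
    HasFDerivAt (fderiv ℝ (transition (d := d) p p'))
      (fderiv ℝ (fderiv ℝ (transition (d := d) p p')) (extChartAt (𝓡 d) p q))
      (extChartAt (𝓡 d) p q) :=
  (((contDiffAt_transition hq hq').fderiv_right (m := 1)
    (by rw [one_add_one_eq_two]; exact ENat.LEInfty.out)).differentiableAt (by norm_num)).hasFDerivAt

/-- The metric in one chart is, near the point, the pullback of the metric in the other. The product
rule applied to this identity gives the terms in `B`, which come from differentiating the Jacobian.
-/
lemma fderiv_chartForm_transition {p p' q : M}
    (hq : q ∈ (chartAt (EuclideanSpace ℝ (Fin d)) p).source)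
    (hq' : q ∈ (chartAt (EuclideanSpace ℝ (Fin d)) p').source)
    (u w z : EuclideanSpace ℝ (Fin d)) :
    let y := extChartAt (𝓡 d) p q
    let y' := extChartAt (𝓡 d) p' q
    let A := fderiv ℝ (transition (d := d) p p') y
    let B := fderiv ℝ (fderiv ℝ (transition (d := d) p p')) y
    fderiv ℝ (chartForm (d := d) p) y u w z
      = fderiv ℝ (chartForm (d := d) p') y' (A u) (A w) (A z)
        + chartForm p' y' (B u w) (A z) + chartForm p' y' (A w) (B u z) := by
  intro y y' A B
  have hτ : HasFDerivAt (transition (d := d) p p') A y :=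
    ((contDiffAt_transition hq hq').differentiableAt (by norm_num)).hasFDerivAt
  have hA : HasFDerivAt (fderiv ℝ (transition (d := d) p p')) B y :=
    hasFDerivAt_fderiv_transition hq hq'
  have hG' : HasFDerivAt (chartForm (d := d) p') (fderiv ℝ (chartForm (d := d) p') y')
      (transition (d := d) p p' y) := by
    rw [transition_extChartAt hq]; exact hasFDerivAt_chartForm hq'
  have h1 := ((hG'.comp y hτ).clm_apply (hA.clm_apply (hasFDerivAt_const w y))).clm_apply
    (hA.clm_apply (hasFDerivAt_const z y))
  have h2 := ((hasFDerivAt_chartForm hq).clm_apply (hasFDerivAt_const w _)).clm_apply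
    (hasFDerivAt_const z _)
  have hev : (fun x => chartForm p x w z) =ᶠ[𝓝 y] fun x =>
      chartForm p' (transition (d := d) p p' x) (fderiv ℝ (transition (d := d) p p') x w)
        (fderiv ℝ (transition (d := d) p p') x z) := by
    have hs : (extChartAt (𝓡 d) p).symm y = q :=
      (extChartAt (𝓡 d) p).left_inv (by simpa using hq)
    have hc : ContinuousAt (extChartAt (𝓡 d) p).symm y := continuousAt_extChartAt_symm' (by simpa using hq)
    filter_upwards [extChartAt_target_mem_nhds' (I := 𝓡 d) (x := p) (y := y)
      ((extChartAt (𝓡 d) p).map_source (by simpa using hq)),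
      hc.preimage_mem_nhds (by rw [hs]; exact (chartAt _ p').open_source.mem_nhds hq')] with x hx hx'
    have hy' := (extChartAt (𝓡 d) p).map_target hx
    rw [extChartAt_source] at hy'
    have := chartForm_transition hy' hx' w z
    rwa [(extChartAt (𝓡 d) p).right_inv hx] at this
  have h3 := congrArg (fun T => T u) (h2.unique (h1.congr_of_eventuallyEq hev))
  have hy' : transition (d := d) p p' y = y' := transition_extChartAt hq
  simp only [add_apply, ContinuousLinearMap.comp_apply, zero_apply, map_zero, zero_add,
    ContinuousLinearMap.flip_apply, Function.comp_apply, hy'] at h3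
  linear_combination h3

/-- Of the six second-derivative terms, four cancel by symmetry of `B` and of the metric, and the
other two coincide. The surviving term is the defect of tensoriality. -/
lemma christoffel_transition {p p' q : M}
    (hq : q ∈ (chartAt (EuclideanSpace ℝ (Fin d)) p).source)
    (hq' : q ∈ (chartAt (EuclideanSpace ℝ (Fin d)) p').source)
    (u w z : EuclideanSpace ℝ (Fin d)) :
    let y := extChartAt (𝓡 d) p q
    let y' := extChartAt (𝓡 d) p' q
    let A := fderiv ℝ (transition (d := d) p p') y
    let B := fderiv ℝ (fderiv ℝ (transition (d := d) p p')) y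
    christoffel p y u w z
      = christoffel p' y' (A u) (A w) (A z) + chartForm p' y' (B u w) (A z) := by
  intro y y' A B
  have hB : ∀ a b, B a b = B b a := fun a b =>
    ((contDiffAt_transition hq hq').isSymmSndFDerivAt (by
      rw [minSmoothness_of_isRCLikeNormedField]; exact ENat.LEInfty.out)) a b
  have key := fun a b c => fderiv_chartForm_transition hq hq' a b c
  simp only at key
  rw [christoffel_eq hq, christoffel_eq hq', key, key, key]
  change (_ + chartForm p' y' (B u w) (A z) + chartForm p' y' (A w) (B u z)
    + (_ + chartForm p' y' (B w u) (A z) + chartForm p' y' (A u) (B w z))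
    - (_ + chartForm p' y' (B z u) (A w) + chartForm p' y' (A u) (B z w))) / 2 = _
  rw [hB w u, hB w z, hB z u, chartForm_symm p' y' (A w) (B u z)]
  ring

/-- The field `V` along `γ` is parallel at time `t`, expressed in the chart around `p`. -/
def IsParallelIn (p : M) (γ : ℝ → M) (V : ∀ t, TangentSpace (𝓡 d) (γ t)) (t : ℝ) : Prop :=
  ∃ v' : EuclideanSpace ℝ (Fin d),
    HasDerivAt (fun s => toCoord p (γ s) (V s)) v' t ∧
    ∀ z : EuclideanSpace ℝ (Fin d),
      chartForm p (extChartAt (𝓡 d) p (γ t)) v' z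
        + christoffel p (extChartAt (𝓡 d) p (γ t)) (toCoord p (γ t) (velocity γ t))
            (toCoord p (γ t) (V t)) z = 0

lemma eventually_mem_chart {γ : ℝ → M} {t : ℝ} {p : M}
    (hγ : MDifferentiableAt 𝓘(ℝ, ℝ) (𝓡 d) γ t)
    (hp : γ t ∈ (chartAt (EuclideanSpace ℝ (Fin d)) p).source) :
    ∀ᶠ s in 𝓝 t, γ s ∈ (chartAt (EuclideanSpace ℝ (Fin d)) p).source :=
  hγ.continuousAt.preimage_mem_nhds ((chartAt _ p).open_source.mem_nhds hp)

/-- The coordinates of a field along a curve are differentiable in every chart if they are so in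
one. -/
lemma hasDerivAt_toCoord_transition {γ : ℝ → M} {V : ∀ t, TangentSpace (𝓡 d) (γ t)} {t : ℝ}
    {p p' : M} (hγ : MDifferentiableAt 𝓘(ℝ, ℝ) (𝓡 d) γ t)
    (hp : γ t ∈ (chartAt (EuclideanSpace ℝ (Fin d)) p).source)
    (hp' : γ t ∈ (chartAt (EuclideanSpace ℝ (Fin d)) p').source)
    {v' : EuclideanSpace ℝ (Fin d)} (hv : HasDerivAt (fun s => toCoord p (γ s) (V s)) v' t) :
    HasDerivAt (fun s => toCoord p' (γ s) (V s))
      (fderiv ℝ (fderiv ℝ (transition (d := d) p p')) (extChartAt (𝓡 d) p (γ t))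
          (toCoord p (γ t) (velocity γ t)) (toCoord p (γ t) (V t))
        + fderiv ℝ (transition (d := d) p p') (extChartAt (𝓡 d) p (γ t)) v') t := by
  have h1 := ((hasFDerivAt_fderiv_transition hp hp').comp_hasDerivAt t
    (toCoord_velocity hγ hp)).clm_apply hv
  refine h1.congr_of_eventuallyEq ?_
  filter_upwards [eventually_mem_chart hγ hp, eventually_mem_chart hγ hp'] with s hs hs'
  exact toCoord_transition hs hs' _

/-- Differentiating the transformed coordinates of `V` produces exactly the second-derivative term
by which the Christoffel symbols fail to be tensorial. -/
lemma IsParallelIn.change {γ : ℝ → M} {V : ∀ t, TangentSpace (𝓡 d) (γ t)} {t : ℝ}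
    {p p' : M} (h : IsParallelIn p γ V t) (hγ : MDifferentiableAt 𝓘(ℝ, ℝ) (𝓡 d) γ t)
    (hp : γ t ∈ (chartAt (EuclideanSpace ℝ (Fin d)) p).source)
    (hp' : γ t ∈ (chartAt (EuclideanSpace ℝ (Fin d)) p').source) :
    IsParallelIn p' γ V t := by
  obtain ⟨v', hv, hz⟩ := h
  refine ⟨_, hasDerivAt_toCoord_transition hγ hp hp' hv, fun z => ?_⟩
  -- The Jacobian is surjective, so testing against its values suffices.
  have hzA : z = fderiv ℝ (transition (d := d) p p') (extChartAt (𝓡 d) p (γ t))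
      (toCoord p (γ t) (ofCoord p' (γ t) z)) := by
    rw [← toCoord_transition hp hp', toCoord_ofCoord hp']
  have h1 := hz (toCoord p (γ t) (ofCoord p' (γ t) z))
  have h2 := christoffel_transition hp hp' (toCoord p (γ t) (velocity γ t)) (toCoord p (γ t) (V t))
    (toCoord p (γ t) (ofCoord p' (γ t) z))
  simp only at h2
  rw [h2, chartForm_transition hp hp', ← hzA, transition_extChartAt hp, ← toCoord_transition hp hp',
    ← toCoord_transition hp hp'] at h1
  rw [map_add, add_apply]
  linarith

lemma isParallelAlong_iff {γ : ℝ → M} {V : ∀ t, TangentSpace (𝓡 d) (γ t)} :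
    IsParallelAlong γ V ↔ ∀ t, MDifferentiableAt 𝓘(ℝ, ℝ) (𝓡 d) γ t ∧ IsParallelIn (γ t) γ V t := by
  refine forall_congr' fun t => and_congr_right fun hγ => ?_
  rw [(toCoord_velocity hγ (mem_chart_source _ _)).deriv]
  rfl

/-- The inner product of parallel fields is constant. -/
lemma IsParallelIn.hasDerivAt_inner {γ : ℝ → M} {V W : ∀ t, TangentSpace (𝓡 d) (γ t)} {t : ℝ}
    {p : M} (hV : IsParallelIn p γ V t) (hW : IsParallelIn p γ W t)
    (hγ : MDifferentiableAt 𝓘(ℝ, ℝ) (𝓡 d) γ t)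
    (hp : γ t ∈ (chartAt (EuclideanSpace ℝ (Fin d)) p).source) :
    HasDerivAt (fun s => inner ℝ (V s) (W s)) 0 t := by
  obtain ⟨v', hv, hvz⟩ := hV
  obtain ⟨w', hw, hwz⟩ := hW
  have h1 := (((hasFDerivAt_chartForm hp).comp_hasDerivAt t (toCoord_velocity hγ hp)).clm_apply
    hv).clm_apply hw
  have hev : (fun s => inner ℝ (V s) (W s)) =ᶠ[𝓝 t] fun s =>
      chartForm p (extChartAt (𝓡 d) p (γ s)) (toCoord p (γ s) (V s)) (toCoord p (γ s) (W s)) := by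
    filter_upwards [eventually_mem_chart hγ hp] with s hs
    exact inner_eq_chartForm hs _ _
  refine (h1.congr_of_eventuallyEq hev).congr_deriv ?_
  have e1 := hvz (toCoord p (γ t) (W t))
  have e2 := hwz (toCoord p (γ t) (V t))
  have e3 := christoffel_add_swap hp (toCoord p (γ t) (velocity γ t)) (toCoord p (γ t) (V t))
    (toCoord p (γ t) (W t))
  change (fderiv ℝ (chartForm (d := d) p) (extChartAt (𝓡 d) p (γ t))
      (toCoord p (γ t) (velocity γ t)) (toCoord p (γ t) (V t)) (toCoord p (γ t) (W t))
    + chartForm p (extChartAt (𝓡 d) p (γ t)) v' (toCoord p (γ t) (W t)))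
    + chartForm p (extChartAt (𝓡 d) p (γ t)) (toCoord p (γ t) (V t)) w' = 0
  rw [chartForm_symm _ _ _ w', ← e3]
  linarith

lemma IsParallelIn.add {γ : ℝ → M} {V W : ∀ t, TangentSpace (𝓡 d) (γ t)} {t : ℝ} {p : M}
    (hp : γ t ∈ (chartAt (EuclideanSpace ℝ (Fin d)) p).source)
    (hV : IsParallelIn p γ V t) (hW : IsParallelIn p γ W t) :
    IsParallelIn p γ (fun s => V s + W s) t := by
  obtain ⟨v', hv, hvz⟩ := hV
  obtain ⟨w', hw, hwz⟩ := hW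
  refine ⟨v' + w', by simpa only [toCoord_add] using! hv.add hw, fun z => ?_⟩
  have e1 := hvz z
  have e2 := hwz z
  rw [christoffel_eq hp] at e1 e2 ⊢
  simp only [toCoord_add, map_add, add_apply]
  linarith

lemma IsParallelIn.smul {γ : ℝ → M} {V : ∀ t, TangentSpace (𝓡 d) (γ t)} {t : ℝ} {p : M}
    (hp : γ t ∈ (chartAt (EuclideanSpace ℝ (Fin d)) p).source) (a : ℝ)
    (hV : IsParallelIn p γ V t) :
    IsParallelIn p γ (fun s => a • V s) t := by
  obtain ⟨v', hv, hvz⟩ := hV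
  refine ⟨a • v', by simpa only [toCoord_smul] using! hv.const_smul a, fun z => ?_⟩
  have e1 := congrArg (a * ·) (hvz z)
  simp only [christoffel_eq hp] at e1 ⊢
  simp only [toCoord_smul, map_smul, smul_apply, smul_eq_mul]
  linarith

lemma IsParallelIn.congr {γ : ℝ → M} {V W : ∀ t, TangentSpace (𝓡 d) (γ t)} {t : ℝ} {p : M}
    (hV : IsParallelIn p γ V t) (h : ∀ᶠ s in 𝓝 t, W s = V s) : IsParallelIn p γ W t := by
  obtain ⟨v', hv, hvz⟩ := hV
  refine ⟨v', hv.congr_of_eventuallyEq (h.mono fun s hs => by simp only [hs]), fun z => ?_⟩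
  rw [h.self_of_nhds]
  exact hvz z

/-- Parallel fields that agree at one time of an interval agree on the interval. -/
lemma eqOn_of_isParallelIn {γ : ℝ → M} {V W : ∀ t, TangentSpace (𝓡 d) (γ t)} {a b t₀ : ℝ}
    (hγ : ∀ t, MDifferentiableAt 𝓘(ℝ, ℝ) (𝓡 d) γ t)
    (hV : ∀ t ∈ Set.Ioo a b, IsParallelIn (γ t) γ V t)
    (hW : ∀ t ∈ Set.Ioo a b, IsParallelIn (γ t) γ W t)
    (ht₀ : t₀ ∈ Set.Ioo a b) (h : V t₀ = W t₀) : ∀ t ∈ Set.Ioo a b, V t = W t := by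
  -- The difference of the fields is parallel, so its norm is constant, and it vanishes at `t₀`.
  set D : ∀ t, TangentSpace (𝓡 d) (γ t) := fun t => V t + (-1 : ℝ) • W t with hD
  have hpar : ∀ t ∈ Set.Ioo a b, IsParallelIn (γ t) γ D t := fun t ht =>
    (hV t ht).add (mem_chart_source _ _) ((hW t ht).smul (mem_chart_source _ _) (-1))
  have hd : ∀ t ∈ Set.Ioo a b, HasDerivAt (fun s => inner ℝ (D s) (D s)) 0 t := fun t ht =>
    (hpar t ht).hasDerivAt_inner (hpar t ht) (hγ t) (mem_chart_source _ _)
  intro t ht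
  have hc : inner ℝ (D t) (D t) = inner ℝ (D t₀) (D t₀) :=
    isOpen_Ioo.is_const_of_deriv_eq_zero isPreconnected_Ioo
      (fun x hx => (hd x hx).differentiableAt.differentiableWithinAt)
      (fun x hx => (hd x hx).deriv) ht ht₀
  have h0 : D t₀ = 0 := by simp [hD, h]
  rw [h0, inner_zero_left, inner_self_eq_zero] at hc
  simpa [hD, neg_one_smul, ← sub_eq_add_neg, sub_eq_zero] using hc

end Parallel

/-! ### Linear differential equations. -/

section LinearODE

/-- Local fundamental solutions of linear differential equations. -/
lemma exists_fundamental_solution {R : Type*} [NormedRing R] [NormedAlgebra ℝ R] [CompleteSpace R]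
    {A : ℝ → R} {t₀ : ℝ} (hA : ∀ᶠ s in 𝓝 t₀, ContinuousAt A s) :
    ∃ (X : ℝ → R) (ε : ℝ), 0 < ε ∧
      ∀ t ∈ Set.Ioo (t₀ - ε) (t₀ + ε), HasDerivAt X (A t * X t) t ∧ IsUnit (X t) := by
  obtain ⟨δ, hδ, hball⟩ := Metric.eventually_nhds_iff.1
    (hA.and (hA.self_of_nhds.norm.eventually_le_const (lt_add_one ‖A t₀‖)))
  -- `K` bounds `‖A t‖` near `t₀` and is the Lipschitz constant; `B` bounds `‖A t * X‖` for `‖X - 1‖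
  -- ≤ 1`; a radius of at most `1 / B` keeps solutions in that ball.
  set K : NNReal := ⟨‖A t₀‖ + 1, by positivity⟩ with hK
  set B : NNReal := K * (‖(1 : R)‖₊ + 1) with hB
  have hBpos : 0 < (B : ℝ) := by
    rw [hB]; push_cast
    have : (0 : ℝ) < K := by change 0 < ‖A t₀‖ + 1; positivity
    positivity
  set r : ℝ := min (δ / 2) (1 / B) with hr
  have hrpos : 0 < r := by positivity
  have hin : ∀ t ∈ Set.Icc (t₀ - r) (t₀ + r), ContinuousAt A t ∧ ‖A t‖ ≤ K := by
    intro t ht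
    refine hball ?_
    have : |t - t₀| ≤ r := abs_le.2 ⟨by linarith [ht.1], by linarith [ht.2]⟩
    rw [Real.dist_eq]
    linarith [min_le_left (δ / 2) (1 / (B : ℝ))]
  have hPL : IsPicardLindelof (fun t X => A t * X)
      (⟨t₀, by constructor <;> linarith⟩ : Set.Icc (t₀ - r) (t₀ + r)) (1 : R) 1 0 B K := by
    refine ⟨fun t ht => ?_, fun x _ => ?_, fun t ht x hx => ?_, ?_⟩
    · refine LipschitzOnWith.of_dist_le_mul fun x _ y _ => ?_
      rw [dist_eq_norm, dist_eq_norm, ← mul_sub]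
      exact (norm_mul_le _ _).trans (by gcongr; exact (hin t ht).2)
    · exact fun t ht => ((hin t ht).1.mul continuousAt_const).continuousWithinAt
    · refine (norm_mul_le _ _).trans ?_
      rw [hB]; push_cast
      have hx' : ‖x‖ ≤ ‖(1 : R)‖ + 1 := by
        have h1 : ‖x - 1‖ ≤ 1 := by simpa [dist_eq_norm] using hx
        have h2 : ‖x‖ ≤ ‖x - 1‖ + ‖(1 : R)‖ := by simpa using norm_add_le (x - 1) 1
        linarith
      gcongr
      exact (hin t ht).2
    · simp only [add_sub_cancel_left, sub_sub_cancel, max_self, NNReal.coe_one, NNReal.coe_zero,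
        sub_zero]
      calc (B : ℝ) * r ≤ B * (1 / B) := by gcongr; exact min_le_right _ _
        _ = 1 := by field_simp
  obtain ⟨X, hX0, hX⟩ := hPL.exists_eq_forall_mem_Icc_hasDerivWithinAt₀
  have hX' : ∀ t ∈ Set.Ioo (t₀ - r) (t₀ + r), HasDerivAt X (A t * X t) t := fun t ht =>
    (hX t (Set.Ioo_subset_Icc_self ht)).hasDerivAt (Icc_mem_nhds ht.1 ht.2)
  have hcont : ContinuousAt X t₀ := (hX' t₀ ⟨by linarith, by linarith⟩).continuousAt
  -- Units form an open set and `X t₀ = 1`.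
  have hunit : ∀ᶠ t in 𝓝 t₀, IsUnit (X t) := by
    refine hcont.preimage_mem_nhds (Units.isOpen.mem_nhds ?_)
    have : X t₀ = 1 := hX0
    simp [this]
  obtain ⟨ε, hε, hu⟩ := Metric.eventually_nhds_iff.1 hunit
  refine ⟨X, min r ε, lt_min hrpos hε, fun t ht => ⟨hX' t ?_, hu ?_⟩⟩
  · exact ⟨by linarith [ht.1, min_le_left r ε], by linarith [ht.2, min_le_left r ε]⟩
  · rw [Real.dist_eq, abs_lt]
    exact ⟨by linarith [ht.1, min_le_right r ε], by linarith [ht.2, min_le_right r ε]⟩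

variable {E : Type*} [NormedAddCommGroup E] [NormedSpace ℝ E] [FiniteDimensional ℝ E]

lemma isInvertible_of_injective {G : E →L[ℝ] E →L[ℝ] ℝ} (hG : Function.Injective G) :
    G.IsInvertible := by
  have hdim : Module.finrank ℝ E = Module.finrank ℝ (E →L[ℝ] ℝ) := by
    rw [← (LinearMap.toContinuousLinearMap (𝕜 := ℝ) (E := E) (F' := ℝ)).finrank_eq]
    exact (Subspace.dual_finrank_eq (K := ℝ) (V := E)).symm
  let e : E ≃ₗ[ℝ] (E →L[ℝ] ℝ) := LinearEquiv.ofInjectiveOfFinrankEq G.toLinearMap hG hdim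
  exact ⟨e.toContinuousLinearEquiv, by ext; rfl⟩

/-- Local solvability of linear differential equations in implicit form. -/
lemma exists_local_solution {G Γ : ℝ → E →L[ℝ] E →L[ℝ] ℝ} {t₀ : ℝ}
    (hG : ∀ᶠ s in 𝓝 t₀, ContinuousAt G s ∧ Function.Injective (G s))
    (hΓ : ∀ᶠ s in 𝓝 t₀, ContinuousAt Γ s) :
    ∃ ε > 0, ∀ t₁ ∈ Set.Ioo (t₀ - ε) (t₀ + ε), ∀ u : E, ∃ v : ℝ → E, v t₁ = u ∧
      ∀ t ∈ Set.Ioo (t₀ - ε) (t₀ + ε), ∃ v', HasDerivAt v v' t ∧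
        ∀ z, G t v' z + Γ t (v t) z = 0 := by
  have : CompleteSpace E := FiniteDimensional.complete ℝ E
  -- The explicit form of the equation is `v' = -G⁻¹ Γ v`.
  obtain ⟨X, ε, hε, hX⟩ := exists_fundamental_solution (R := E →L[ℝ] E) (t₀ := t₀)
    (A := fun s => -((G s).inverse ∘L Γ s)) (by
      filter_upwards [hG, hΓ] with s hs hs'
      exact (((isInvertible_of_injective hs.2).contDiffAt_map_inverse
        (n := 0)).continuousAt.comp hs.1).clm_comp hs' |>.neg)
  obtain ⟨δ, hδ, hinv⟩ := Metric.eventually_nhds_iff.1 hG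
  have hsub : ∀ t ∈ Set.Ioo (t₀ - min ε δ) (t₀ + min ε δ),
      t ∈ Set.Ioo (t₀ - ε) (t₀ + ε) ∧ Function.Injective (G t) := by
    intro t ht
    refine ⟨⟨by linarith [ht.1, min_le_left ε δ], by linarith [ht.2, min_le_left ε δ]⟩,
      (hinv ?_).2⟩
    rw [Real.dist_eq, abs_lt]
    exact ⟨by linarith [ht.1, min_le_right ε δ], by linarith [ht.2, min_le_right ε δ]⟩
  refine ⟨min ε δ, lt_min hε hδ, fun t₁ ht₁ u => ?_⟩
  obtain ⟨Y, hY⟩ := (hX t₁ (hsub t₁ ht₁).1).2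
  -- One fundamental solution serves every `t₁` and `u`, so the interval depends on neither.
  -- Continuation past an end point relies on this uniformity.
  refine ⟨fun t => X t ((↑Y⁻¹ : E →L[ℝ] E) u), ?_, fun t ht => ?_⟩
  · have : (X t₁ * (↑Y⁻¹ : E →L[ℝ] E)) u = u := by rw [← hY, Units.mul_inv]; rfl
    exact this
  · have h1 := (hX t (hsub t ht).1).1.clm_apply (hasDerivAt_const t ((↑Y⁻¹ : E →L[ℝ] E) u))
    refine ⟨_, h1, fun z => ?_⟩
    obtain ⟨e, he⟩ := isInvertible_of_injective (hsub t ht).2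
    have h2 : ∀ w, G t ((G t).inverse w) = w := by
      intro w; rw [← he]; simp
    simp [h2]

end LinearODE

/-! ### Local existence of parallel fields along geodesics. -/

section Parallel

variable {d : ℕ} {M : Type*} [TopologicalSpace M]
  [ChartedSpace (EuclideanSpace ℝ (Fin d)) M] [IsManifold (𝓡 d) ∞ M]
  [RiemannianBundle (fun x : M => TangentSpace (𝓡 d) x)]
  [IsContMDiffRiemannianBundle (𝓡 d) ∞ (EuclideanSpace ℝ (Fin d))
          (fun x : M => TangentSpace (𝓡 d) x)]

lemma chartForm_injective {p q : M} (hq : q ∈ (chartAt (EuclideanSpace ℝ (Fin d)) p).source) :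
    Function.Injective (chartForm (d := d) p (extChartAt (𝓡 d) p q)) := by
  rw [injective_iff_map_eq_zero]
  intro v hv
  have h := inner_eq_chartForm hq (ofCoord p q v) (ofCoord p q v)
  rw [toCoord_ofCoord hq, hv] at h
  have h0 : (ofCoord p q v : TangentSpace (𝓡 d) q) = 0 := inner_self_eq_zero.1 (h.trans rfl)
  rw [← toCoord_ofCoord hq v, h0]
  exact map_zero _

/-- The Christoffel symbols in a chart, contracted with a vector, as a bilinear form. -/
def christoffelForm (p : M) (y u : EuclideanSpace ℝ (Fin d)) :
    EuclideanSpace ℝ (Fin d) →L[ℝ] EuclideanSpace ℝ (Fin d) →L[ℝ] ℝ :=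
  (1 / 2 : ℝ) • (fderiv ℝ (chartForm (d := d) p) y u
    + (fderiv ℝ (chartForm (d := d) p) y).flip u - ((fderiv ℝ (chartForm (d := d) p) y).flip u).flip)

lemma christoffelForm_apply {p q : M} (hq : q ∈ (chartAt (EuclideanSpace ℝ (Fin d)) p).source)
    (u w z : EuclideanSpace ℝ (Fin d)) :
    christoffelForm p (extChartAt (𝓡 d) p q) u w z = christoffel p (extChartAt (𝓡 d) p q) u w z := by
  rw [christoffel_eq hq]
  change (1 / 2 : ℝ) * (fderiv ℝ (chartForm (d := d) p) (extChartAt (𝓡 d) p q) u w z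
    + fderiv ℝ (chartForm (d := d) p) (extChartAt (𝓡 d) p q) w u z
    - fderiv ℝ (chartForm (d := d) p) (extChartAt (𝓡 d) p q) z u w) = _
  ring

lemma continuousAt_christoffelForm {p : M} {γ : ℝ → M} {s : ℝ} {c : ℝ → EuclideanSpace ℝ (Fin d)}
    (hp : γ s ∈ (chartAt (EuclideanSpace ℝ (Fin d)) p).source)
    (hγ : MDifferentiableAt 𝓘(ℝ, ℝ) (𝓡 d) γ s) (hc : ContinuousAt c s) :
    ContinuousAt (fun s => christoffelForm p (extChartAt (𝓡 d) p (γ s)) (c s)) s := by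
  have hD : ContinuousAt (fun s => fderiv ℝ (chartForm (d := d) p) (extChartAt (𝓡 d) p (γ s))) s :=
    ContinuousAt.comp (f := fun s => extChartAt (𝓡 d) p (γ s))
      (g := fderiv ℝ (chartForm (d := d) p))
      ((contDiffAt_chartForm hp).fderiv_right (m := 0) (by simp)).continuousAt
      (toCoord_velocity hγ hp).continuousAt
  have hF : ContinuousAt
      (fun s => (fderiv ℝ (chartForm (d := d) p) (extChartAt (𝓡 d) p (γ s))).flip (c s)) s :=
    ((ContinuousLinearMap.flipₗᵢ ℝ _ _ _).continuous.continuousAt.comp hD).clm_apply hc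
  exact (((hD.clm_apply hc).add hF).sub
    ((ContinuousLinearMap.flipₗᵢ ℝ _ _ _).continuous.continuousAt.comp hF)).const_smul (1 / 2 : ℝ)

/-- Parallel fields along a geodesic exist locally. -/
lemma IsGeodesic.exists_local_parallel {γ : ℝ → M} (hγ : IsGeodesic (d := d) γ) (t₀ : ℝ) :
    ∃ ε > 0, ∀ t₁ ∈ Set.Ioo (t₀ - ε) (t₀ + ε), ∀ u : TangentSpace (𝓡 d) (γ t₁),
      ∃ V : ∀ t, TangentSpace (𝓡 d) (γ t), V t₁ = u ∧
        ∀ t ∈ Set.Ioo (t₀ - ε) (t₀ + ε), IsParallelIn (γ t) γ V t := by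
  have hγ' := isParallelAlong_iff.1 hγ
  have hsrc := eventually_mem_chart (hγ' t₀).1 (mem_chart_source _ (γ t₀))
  obtain ⟨δ, hδ, hδs⟩ := Metric.eventually_nhds_iff.1 hsrc
  obtain ⟨ε, hε, H⟩ := exists_local_solution (t₀ := t₀)
    (G := fun s => chartForm (d := d) (γ t₀) (extChartAt (𝓡 d) (γ t₀) (γ s)))
    (Γ := fun s => christoffelForm (γ t₀) (extChartAt (𝓡 d) (γ t₀) (γ s))
      (toCoord (γ t₀) (γ s) (velocity γ s)))
    (by
      filter_upwards [hsrc] with s hs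
      exact ⟨ContinuousAt.comp (f := fun s => extChartAt (𝓡 d) (γ t₀) (γ s))
        (contDiffAt_chartForm hs).continuousAt (toCoord_velocity (hγ' s).1 hs).continuousAt,
        chartForm_injective hs⟩)
    (by
      filter_upwards [hsrc] with s hs
      -- The coefficients are continuous because the velocity of a geodesic is itself parallel,
      -- hence differentiable in coordinates.
      obtain ⟨v', hv, -⟩ := (hγ' s).2
      exact continuousAt_christoffelForm hs (hγ' s).1
        (hasDerivAt_toCoord_transition (hγ' s).1 (mem_chart_source _ _) hs hv).continuousAt)
  have hsub : ∀ t ∈ Set.Ioo (t₀ - min ε δ) (t₀ + min ε δ),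
      t ∈ Set.Ioo (t₀ - ε) (t₀ + ε) ∧
        γ t ∈ (chartAt (EuclideanSpace ℝ (Fin d)) (γ t₀)).source := by
    intro t ht
    refine ⟨⟨by linarith [ht.1, min_le_left ε δ], by linarith [ht.2, min_le_left ε δ]⟩, hδs ?_⟩
    rw [Real.dist_eq, abs_lt]
    exact ⟨by linarith [ht.1, min_le_right ε δ], by linarith [ht.2, min_le_right ε δ]⟩
  refine ⟨min ε δ, lt_min hε hδ, fun t₁ ht₁ u => ?_⟩
  obtain ⟨v, hv₁, hv⟩ := H t₁ (hsub t₁ ht₁).1 (toCoord (γ t₀) (γ t₁) u)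
  refine ⟨fun t => ofCoord (γ t₀) (γ t) (v t), ?_, fun t ht => ?_⟩
  · simp only [hv₁, ofCoord_toCoord (hsub t₁ ht₁).2]
  · have ht' := hsub t ht
    obtain ⟨v', hv', hz⟩ := hv t ht'.1
    refine IsParallelIn.change (p := γ t₀) ⟨v', ?_, fun z => ?_⟩ (hγ' t).1 ht'.2
      (mem_chart_source _ _)
    · refine hv'.congr_of_eventuallyEq ?_
      filter_upwards [eventually_mem_chart (hγ' t).1 ht'.2] with s hs
      exact toCoord_ofCoord hs _
    · rw [toCoord_ofCoord ht'.2, ← christoffelForm_apply ht'.2]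
      exact hz z

end Parallel

/-! ### Global parallel transport and the descent inequality. -/

section Transport

variable {d : ℕ} {M : Type*} [TopologicalSpace M]
  [ChartedSpace (EuclideanSpace ℝ (Fin d)) M] [IsManifold (𝓡 d) ∞ M]
  [RiemannianBundle (fun x : M => TangentSpace (𝓡 d) x)]
  [IsContMDiffRiemannianBundle (𝓡 d) ∞ (EuclideanSpace ℝ (Fin d))
          (fun x : M => TangentSpace (𝓡 d) x)]

open Classical in
/-- Parallel fields with a common initial value glue to a field that is parallel wherever one of
them is. -/
lemma exists_glued_parallel {γ : ℝ → M} (hγ : ∀ t, MDifferentiableAt 𝓘(ℝ, ℝ) (𝓡 d) γ t) {a : ℝ}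
    {u : TangentSpace (𝓡 d) (γ a)} {S : Set ℝ} (hS : S.Nonempty) (hpos : ∀ r ∈ S, 0 < r)
    (h : ∀ r ∈ S, ∃ V : ∀ t, TangentSpace (𝓡 d) (γ t), V a = u ∧
      ∀ t ∈ Set.Ioo (a - r) (a + r), IsParallelIn (γ t) γ V t) :
    ∃ V : ∀ t, TangentSpace (𝓡 d) (γ t), V a = u ∧
      ∀ r ∈ S, ∀ t ∈ Set.Ioo (a - r) (a + r), IsParallelIn (γ t) γ V t := by
  choose! F hFa hF using h
  -- `R t` will be a radius in `S` whose interval contains `t`; the default `0` occurs only where no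
  -- interval reaches.
  have hE : ∀ t, ∃ r : ℝ, (∃ r' ∈ S, t ∈ Set.Ioo (a - r') (a + r')) →
      r ∈ S ∧ t ∈ Set.Ioo (a - r) (a + r) := by
    intro t
    by_cases ht : ∃ r' ∈ S, t ∈ Set.Ioo (a - r') (a + r')
    · obtain ⟨r, hr⟩ := ht
      exact ⟨r, fun _ => hr⟩
    · exact ⟨0, fun h => absurd h ht⟩
  choose R hR using hE
  have key : ∀ r ∈ S, ∀ t ∈ Set.Ioo (a - r) (a + r), F (R t) t = F r t := by
    intro r hr t ht
    obtain ⟨hRS, htR⟩ := hR t ⟨r, hr, ht⟩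
    have hm1 := min_le_left r (R t)
    have hm2 := min_le_right r (R t)
    have hm : 0 < min r (R t) := lt_min (hpos r hr) (hpos _ hRS)
    refine eqOn_of_isParallelIn (a := a - min r (R t)) (b := a + min r (R t)) (t₀ := a) hγ
      (fun s hs => hF _ hRS s ⟨by linarith [hs.1], by linarith [hs.2]⟩)
      (fun s hs => hF _ hr s ⟨by linarith [hs.1], by linarith [hs.2]⟩)
      ⟨by linarith, by linarith⟩ (by rw [hFa _ hRS, hFa _ hr]) t ?_
    rcases min_choice r (R t) with h | h <;> rw [h] <;> assumption
  refine ⟨fun t => F (R t) t, ?_, fun r hr t ht => ?_⟩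
  · obtain ⟨r, hr⟩ := hS
    have := hpos r hr
    exact (key r hr a ⟨by linarith, by linarith⟩).trans (hFa r hr)
  · refine (hF r hr t ht).congr ?_
    filter_upwards [isOpen_Ioo.mem_nhds ht] with s hs
    exact key r hr s hs

open Classical in
/-- A parallel field on a bounded interval extends beyond its end points. -/
lemma IsGeodesic.exists_extension {γ : ℝ → M} (hγ : IsGeodesic (d := d) γ) {a R : ℝ} (hR : 0 < R)
    {V : ∀ t, TangentSpace (𝓡 d) (γ t)}
    (hV : ∀ t ∈ Set.Ioo (a - R) (a + R), IsParallelIn (γ t) γ V t) :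
    ∃ ε > 0, ∃ W : ∀ t, TangentSpace (𝓡 d) (γ t), W a = V a ∧
      ∀ t ∈ Set.Ioo (a - (R + ε)) (a + (R + ε)), IsParallelIn (γ t) γ W t := by
  have hγ' := fun t => (isParallelAlong_iff.1 hγ t).1
  obtain ⟨ε₁, hε₁, H₁⟩ := hγ.exists_local_parallel (a + R)
  obtain ⟨ε₂, hε₂, H₂⟩ := hγ.exists_local_parallel (a - R)
  set ε := min R (min ε₁ ε₂) with hε
  have hεpos : 0 < ε := by positivity
  have hεR : ε ≤ R := min_le_left _ _
  have hε1 : ε ≤ ε₁ := (min_le_right _ _).trans (min_le_left _ _)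
  have hε2 : ε ≤ ε₂ := (min_le_right _ _).trans (min_le_right _ _)
  -- The local solutions are matched with `V` strictly inside the interval; they then agree with it
  -- up to the end points, and `W` switches at the matching points.
  obtain ⟨W₁, hW₁, hp₁⟩ := H₁ (a + R - ε / 2) ⟨by linarith, by linarith⟩ (V _)
  obtain ⟨W₂, hW₂, hp₂⟩ := H₂ (a - R + ε / 2) ⟨by linarith, by linarith⟩ (V _)
  have e₁ : ∀ t ∈ Set.Ioo (a + R - ε) (a + R), W₁ t = V t :=
    eqOn_of_isParallelIn hγ' (fun t ht => hp₁ t ⟨by linarith [ht.1], by linarith [ht.2]⟩)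
      (fun t ht => hV t ⟨by linarith [ht.1], by linarith [ht.2]⟩)
      ⟨by linarith, by linarith⟩ hW₁
  have e₂ : ∀ t ∈ Set.Ioo (a - R) (a - R + ε), W₂ t = V t :=
    eqOn_of_isParallelIn hγ' (fun t ht => hp₂ t ⟨by linarith [ht.1], by linarith [ht.2]⟩)
      (fun t ht => hV t ⟨by linarith [ht.1], by linarith [ht.2]⟩)
      ⟨by linarith, by linarith⟩ hW₂
  let W : ∀ t, TangentSpace (𝓡 d) (γ t) := fun t =>
    if a + R - ε / 2 < t then W₁ t else if t < a - R + ε / 2 then W₂ t else V t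
  have eV : ∀ t ∈ Set.Ioo (a - R) (a + R), W t = V t := by
    intro t ht
    simp only [W]
    split_ifs with h1 h2
    · exact e₁ t ⟨by linarith, ht.2⟩
    · exact e₂ t ⟨ht.1, by linarith⟩
    · rfl
  refine ⟨ε, hεpos, W, eV a ⟨by linarith, by linarith⟩, fun t ht => ?_⟩
  rcases lt_or_ge t (a + R) with h1 | h1
  · rcases lt_or_ge (a - R) t with h2 | h2
    · refine (hV t ⟨h2, h1⟩).congr ?_
      filter_upwards [isOpen_Ioo.mem_nhds (⟨h2, h1⟩ : t ∈ Set.Ioo (a - R) (a + R))] with s hs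
      exact eV s hs
    · refine (hp₂ t ⟨by linarith [ht.1], by linarith⟩).congr ?_
      filter_upwards [isOpen_Iio.mem_nhds (show t ∈ Set.Iio (a - R + ε / 2) from
        Set.mem_Iio.2 (by linarith))] with s hs
      rw [Set.mem_Iio] at hs
      simp only [W]
      rw [if_neg (by linarith), if_pos hs]
  · refine (hp₁ t ⟨by linarith, by linarith [ht.2]⟩).congr ?_
    filter_upwards [isOpen_Ioi.mem_nhds (show t ∈ Set.Ioi (a + R - ε / 2) from
      Set.mem_Ioi.2 (by linarith))] with s hs
    simp only [W]
    rw [if_pos (Set.mem_Ioi.1 hs)]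

/-- Parallel fields along geodesics exist for all times. -/
lemma IsGeodesic.exists_parallel {γ : ℝ → M} (hγ : IsGeodesic (d := d) γ) (a : ℝ)
    (u : TangentSpace (𝓡 d) (γ a)) :
    ∃ V : ∀ t, TangentSpace (𝓡 d) (γ t), V a = u ∧ IsParallelAlong γ V := by
  have hγ' := fun t => (isParallelAlong_iff.1 hγ t).1
  set S : Set ℝ := {r | 0 < r ∧ ∃ V : ∀ t, TangentSpace (𝓡 d) (γ t), V a = u ∧
      ∀ t ∈ Set.Ioo (a - r) (a + r), IsParallelIn (γ t) γ V t} with hSdef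
  have hne : S.Nonempty := by
    obtain ⟨ε, hε, H⟩ := hγ.exists_local_parallel a
    exact ⟨ε, hε, H a ⟨by linarith, by linarith⟩ u⟩
  obtain ⟨V, hVa, hV⟩ := exists_glued_parallel hγ' hne (fun r hr => hr.1) (fun r hr => hr.2)
  -- The glued field is parallel out to radius `sSup S`; an extension of it would put a larger
  -- radius in `S`.
  have hunb : ¬ BddAbove S := by
    intro hb
    have hR : 0 < sSup S := by
      obtain ⟨r, hr⟩ := hne
      exact hr.1.trans_le (le_csSup hb hr)
    obtain ⟨ε, hε, W, hWa, hW⟩ := hγ.exists_extension (a := a) (V := V) hR (by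
      intro t ht
      have : |t - a| < sSup S := abs_lt.2 ⟨by linarith [ht.1], by linarith [ht.2]⟩
      obtain ⟨r, hr, hlt⟩ := exists_lt_of_lt_csSup hne this
      rw [abs_lt] at hlt
      exact hV r hr t ⟨by linarith [hlt.1], by linarith [hlt.2]⟩)
    have hmem : sSup S + ε ∈ S := ⟨by linarith, W, hWa.trans hVa, hW⟩
    linarith [le_csSup hb hmem]
  refine ⟨V, hVa, isParallelAlong_iff.2 fun t => ⟨hγ' t, ?_⟩⟩
  obtain ⟨r, hr, hlt⟩ := not_bddAbove_iff.1 hunb |t - a|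
  rw [abs_lt] at hlt
  exact hV r hr t ⟨by linarith [hlt.1], by linarith [hlt.2]⟩

lemma IsParallelAlong.eq_of_eq {γ : ℝ → M} {V W : ∀ t, TangentSpace (𝓡 d) (γ t)}
    (hV : IsParallelAlong γ V) (hW : IsParallelAlong γ W) {a : ℝ} (h : V a = W a) (b : ℝ) :
    V b = W b := by
  rw [isParallelAlong_iff] at hV hW
  refine eqOn_of_isParallelIn (a := min a b - 1) (b := max a b + 1) (t₀ := a)
    (fun t => (hV t).1) (fun t _ => (hV t).2) (fun t _ => (hW t).2) ⟨?_, ?_⟩ h b ⟨?_, ?_⟩ <;>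
  linarith [min_le_left a b, min_le_right a b, le_max_left a b, le_max_right a b]

/-- Uniqueness makes the choice inside `parallelTransport` immaterial, so any parallel field at hand
computes it. -/
lemma IsParallelAlong.parallelTransport_eq {γ : ℝ → M} {V : ∀ t, TangentSpace (𝓡 d) (γ t)}
    (hV : IsParallelAlong γ V) (a b : ℝ) :
    parallelTransport γ a b ⟨γ a, V a⟩ = V b := by
  have h : ∃ W : ∀ t, TangentSpace (𝓡 d) (γ t), IsParallelAlong γ W ∧
      (⟨γ a, W a⟩ : TangentBundle (𝓡 d) M) = ⟨γ a, V a⟩ := ⟨V, hV, rfl⟩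
  rw [parallelTransport, dif_pos h]
  exact h.choose_spec.1.eq_of_eq hV (TotalSpace.mk_injective _ h.choose_spec.2) b

lemma IsParallelAlong.inner_eq {γ : ℝ → M} {V W : ∀ t, TangentSpace (𝓡 d) (γ t)}
    (hV : IsParallelAlong γ V) (hW : IsParallelAlong γ W) (a b : ℝ) :
    inner ℝ (V a) (W a) = inner ℝ (V b) (W b) := by
  rw [isParallelAlong_iff] at hV hW
  have h := fun t => (hV t).2.hasDerivAt_inner (hW t).2 (hV t).1 (mem_chart_source _ _)
  exact is_const_of_deriv_eq_zero (fun t => (h t).differentiableAt) (fun t => (h t).deriv) a b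

lemma IsParallelAlong.add {γ : ℝ → M} {V W : ∀ t, TangentSpace (𝓡 d) (γ t)}
    (hV : IsParallelAlong γ V) (hW : IsParallelAlong γ W) :
    IsParallelAlong γ (fun t => V t + W t) := by
  rw [isParallelAlong_iff] at *
  exact fun t => ⟨(hV t).1, (hV t).2.add (mem_chart_source _ _) (hW t).2⟩

lemma IsParallelAlong.smul {γ : ℝ → M} {V : ∀ t, TangentSpace (𝓡 d) (γ t)}
    (hV : IsParallelAlong γ V) (r : ℝ) :
    IsParallelAlong γ (fun t => r • V t) := by
  rw [isParallelAlong_iff] at *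
  exact fun t => ⟨(hV t).1, (hV t).2.smul (mem_chart_source _ _) r⟩

lemma hasMFDerivAt_mul_left (r t : ℝ) :
    HasMFDerivAt 𝓘(ℝ, ℝ) 𝓘(ℝ, ℝ) (fun s : ℝ => r * s) t
      (ContinuousLinearMap.toSpanSingleton ℝ r) := by
  have h : HasDerivAt (fun s : ℝ => r * s) r t := by simpa using (hasDerivAt_id t).const_mul r
  exact h.hasFDerivAt.hasMFDerivAt

lemma velocity_comp_mul {γ : ℝ → M} {r t : ℝ}
    (hγ : MDifferentiableAt 𝓘(ℝ, ℝ) (𝓡 d) γ (r * t)) :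
    velocity (d := d) (fun s => γ (r * s)) t = r • velocity (d := d) γ (r * t) := by
  have h := (hγ.hasMFDerivAt.comp t (hasMFDerivAt_mul_left r t)).mfderiv
  unfold velocity
  refine (congrArg (fun T => T (1 : ℝ)) h).trans ?_
  have h1 : (ContinuousLinearMap.toSpanSingleton ℝ r) (1 : ℝ) = r • (1 : ℝ) := by simp
  exact (congrArg (mfderiv 𝓘(ℝ, ℝ) (𝓡 d) γ (r * t)) h1).trans (map_smul _ r (1 : ℝ))

/-- The equation is homogeneous of degree one in the pair formed by the velocity and `v'`. Rescaling
time is needed because `IsGSmooth` compares only the times `0` and `1`. -/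
lemma IsParallelAlong.comp_mul {γ : ℝ → M} {V : ∀ t, TangentSpace (𝓡 d) (γ t)}
    (hV : IsParallelAlong γ V) (r : ℝ) :
    IsParallelAlong (fun s => γ (r * s)) (fun s => V (r * s)) := by
  rw [isParallelAlong_iff] at *
  intro t
  refine ⟨(hV (r * t)).1.comp t (hasMFDerivAt_mul_left r t).mdifferentiableAt, ?_⟩
  obtain ⟨v', hv, hz⟩ := (hV (r * t)).2
  have hmul : HasDerivAt (fun s : ℝ => r * s) r t := by simpa using (hasDerivAt_id t).const_mul r
  refine ⟨r • v', hv.scomp t hmul, fun z => ?_⟩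
  have e := congrArg (r * ·) (hz z)
  rw [velocity_comp_mul (hV (r * t)).1]
  simp only [christoffel_eq (mem_chart_source (EuclideanSpace ℝ (Fin d)) (γ (r * t)))] at e ⊢
  simp only [toCoord_smul, map_smul, smul_apply, smul_eq_mul]
  linarith

lemma IsGeodesic.comp_mul {γ : ℝ → M} (hγ : IsGeodesic (d := d) γ) (r : ℝ) :
    IsGeodesic (d := d) (fun s => γ (r * s)) := by
  have h := (IsParallelAlong.comp_mul hγ r).smul r
  have e : velocity (d := d) (fun s => γ (r * s)) = fun s => r • velocity (d := d) γ (r * s) :=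
    funext fun s => velocity_comp_mul ((isParallelAlong_iff.1 hγ _).1)
  rw [IsGeodesic, e]
  exact h

lemma inner_riemGrad (f : M → ℝ) (x : M) (v : TangentSpace (𝓡 d) x) :
    inner ℝ (riemGrad (d := d) f x) v = mvfderiv (𝓡 d) f x v := by
  have : FiniteDimensional ℝ (TangentSpace (𝓡 d) x) :=
    inferInstanceAs (FiniteDimensional ℝ (EuclideanSpace ℝ (Fin d)))
  have : CompleteSpace (TangentSpace (𝓡 d) x) :=
    FiniteDimensional.complete ℝ (TangentSpace (𝓡 d) x)
  exact InnerProductSpace.toDual_symm_apply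

lemma hasDerivAt_comp_curve {f : M → ℝ} {γ : ℝ → M} {t : ℝ}
    (hf : MDifferentiableAt (𝓡 d) 𝓘(ℝ, ℝ) f (γ t)) (hγ : MDifferentiableAt 𝓘(ℝ, ℝ) (𝓡 d) γ t) :
    HasDerivAt (fun s => f (γ s)) (inner ℝ (riemGrad (d := d) f (γ t)) (velocity (d := d) γ t)) t := by
  rw [inner_riemGrad]
  have h := (hf.comp t hγ).differentiableAt.hasFDerivAt.hasDerivAt
  rw [← mfderiv_eq_fderiv, mfderiv_comp t hf hγ] at h
  exact h

/-- The gradients of a geodesically smooth function along a geodesic, transported to its start. -/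
lemma IsGSmooth.norm_sub_le {L : ℝ} {f : M → ℝ} (hf : IsGSmooth d L f) {γ : ℝ → M}
    (hγ : IsGeodesic (d := d) γ) {t : ℝ} (ht : 0 ≤ t) {V : ∀ t, TangentSpace (𝓡 d) (γ t)}
    (hV : IsParallelAlong γ V) (hVt : V t = riemGrad f (γ t)) :
    ‖riemGrad (d := d) f (γ 0) - V 0‖ ≤ L * (t * ‖velocity (d := d) γ 0‖) := by
  have h := hf.2 _ (hγ.comp_mul t)
  have e : riemGrad (d := d) f (γ (t * 1)) = V (t * 1) := by rw [mul_one, hVt]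
  rw [e, (hV.comp_mul t).parallelTransport_eq 1 0,
    velocity_comp_mul ((isParallelAlong_iff.1 hγ _).1), norm_smul, mul_zero, Real.norm_eq_abs,
    abs_of_nonneg ht] at h
  exact h

/-- The velocity is parallel, so moving the gradient at time `t` back to time `0` preserves its
product with the velocity, and the derivative of `f ∘ γ` is at most `c + L * t * N ^ 2`. Subtracting
the quadratic primitive leaves an antitone function, which avoids integrating a derivative. -/
lemma IsGSmooth.descent {L : ℝ} {f : M → ℝ} (hf : IsGSmooth d L f) {γ : ℝ → M}
    (hγ : IsGeodesic (d := d) γ) :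
    f (γ 1) ≤ f (γ 0) + inner ℝ (riemGrad (d := d) f (γ 0)) (velocity (d := d) γ 0)
      + L / 2 * ‖velocity (d := d) γ 0‖ ^ 2 := by
  set c := inner ℝ (riemGrad (d := d) f (γ 0)) (velocity (d := d) γ 0) with hc
  set N := ‖velocity (d := d) γ 0‖ with hN
  have hd : ∀ t, HasDerivAt (fun s => f (γ s)) (inner ℝ (riemGrad (d := d) f (γ t)) (velocity (d := d) γ t)) t :=
    fun t => hasDerivAt_comp_curve (hf.1 _) (isParallelAlong_iff.1 hγ t).1
  have hb : ∀ t, 0 ≤ t → inner ℝ (riemGrad (d := d) f (γ t)) (velocity (d := d) γ t) ≤ c + L * t * N ^ 2 := by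
    intro t ht
    obtain ⟨V, hVt, hV⟩ := hγ.exists_parallel t (riemGrad f (γ t))
    have h1 := hf.norm_sub_le hγ ht hV hVt
    rw [← hVt, hV.inner_eq hγ t 0]
    have h2 : inner ℝ (V 0) (velocity γ 0)
        = c + inner ℝ (V 0 - riemGrad f (γ 0)) (velocity (d := d) γ 0) := by
      rw [inner_sub_left, hc]; ring
    have h3 := real_inner_le_norm (V 0 - riemGrad f (γ 0)) (velocity (d := d) γ 0)
    rw [norm_sub_rev] at h3
    have h4 : ‖riemGrad (d := d) f (γ 0) - V 0‖ * N ≤ L * (t * N) * N := by gcongr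
    rw [h2]
    nlinarith
  have hg : ∀ t, HasDerivAt (fun s => f (γ s) - (c * s + L / 2 * N ^ 2 * s ^ 2))
      (inner ℝ (riemGrad (d := d) f (γ t)) (velocity (d := d) γ t) - (c + L * t * N ^ 2)) t := by
    intro t
    have h1 : HasDerivAt (fun s : ℝ => c * s + L / 2 * N ^ 2 * s ^ 2) (c + L * t * N ^ 2) t := by
      refine (((hasDerivAt_id t).const_mul c).add
        ((hasDerivAt_pow 2 t).const_mul (L / 2 * N ^ 2))).congr_deriv ?_
      norm_num
      ring
    exact (hd t).sub h1
  have hanti := antitoneOn_of_deriv_nonpos (convex_Icc (0 : ℝ) 1)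
    (fun t _ => (hg t).continuousAt.continuousWithinAt)
    (fun t _ => (hg t).differentiableAt.differentiableWithinAt)
    (fun t ht => by
      rw [interior_Icc] at ht
      rw [(hg t).deriv]
      linarith [hb t ht.1.le])
  have := hanti (Set.left_mem_Icc.2 zero_le_one) (Set.right_mem_Icc.2 zero_le_one) zero_le_one
  simp only at this
  nlinarith

/-- Parallel transport along a geodesic is a linear isometry which controls the gradients of
geodesically smooth functions. -/
lemma IsGeodesic.exists_transport {γ : ℝ → M} (hγ : IsGeodesic (d := d) γ) {x : M}
    {v : TangentSpace (𝓡 d) x}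
    (h : (⟨γ 0, velocity γ 0⟩ : TangentBundle (𝓡 d) M) = ⟨x, v⟩) :
    ∃ T : TangentSpace (𝓡 d) x →ₗ[ℝ] TangentSpace (𝓡 d) (γ 1),
      (∀ u, parallelTransport γ 0 1 ⟨x, u⟩ = T u) ∧ (∀ u, ‖T u‖ = ‖u‖) ∧
      ∀ (L : ℝ) (f : M → ℝ), IsGSmooth d L f →
        ‖riemGrad f (γ 1) - T (riemGrad f x)‖ ≤ L * ‖v‖ ∧
        f (γ 1) ≤ f x + inner ℝ (riemGrad (d := d) f x) v + L / 2 * ‖v‖ ^ 2 := by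
  obtain rfl : γ 0 = x := congrArg TotalSpace.proj h
  obtain rfl : velocity γ 0 = v := TotalSpace.mk_injective _ h
  choose F hF0 hF using hγ.exists_parallel 0
  have hadd : ∀ u w, F (u + w) 1 = F u 1 + F w 1 := fun u w =>
    (hF (u + w)).eq_of_eq ((hF u).add (hF w)) (a := 0) (by simp only [hF0]) 1
  have hsmul : ∀ (r : ℝ) u, F (r • u) 1 = r • F u 1 := fun r u =>
    (hF (r • u)).eq_of_eq ((hF u).smul r) (a := 0) (by simp only [hF0]) 1
  have hnorm : ∀ {V : ∀ t, TangentSpace (𝓡 d) (γ t)}, IsParallelAlong γ V → ‖V 1‖ = ‖V 0‖ := by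
    intro V hV
    rw [@norm_eq_sqrt_real_inner _ _ _ (V 1), @norm_eq_sqrt_real_inner _ _ _ (V 0),
      hV.inner_eq hV 1 0]
  refine ⟨{ toFun := fun u => F u 1, map_add' := hadd, map_smul' := hsmul }, fun u => ?_,
    fun u => ?_, fun L f hf => ⟨?_, hf.descent hγ⟩⟩
  · have := (hF u).parallelTransport_eq 0 1
    rwa [hF0] at this
  · change ‖F u 1‖ = ‖u‖
    rw [hnorm (hF u), hF0]
  · change ‖riemGrad f (γ 1) - F (riemGrad f (γ 0)) 1‖ ≤ _
    obtain ⟨V, hV1, hV⟩ := hγ.exists_parallel 1 (riemGrad f (γ 1))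
    have h1 := hf.norm_sub_le hγ zero_le_one hV hV1
    -- The smoothness bound compares gradients at `γ 0`; the isometry carries it to `γ 1`.
    have h2 := hnorm (hV.add ((hF (riemGrad f (γ 0))).smul (-1)))
    simp only [hV1, hF0, neg_one_smul, ← sub_eq_add_neg] at h2
    rw [h2, norm_sub_rev]
    linarith

/-- Completeness ensures that `geodesic x v` is a genuine geodesic with initial velocity `v`. Which
one was chosen does not matter, so uniqueness of geodesics is never used. -/
lemma exists_expTransport (hM : GeodesicallyComplete d M) (x : M) (v : TangentSpace (𝓡 d) x) :
    ∃ T : TangentSpace (𝓡 d) x →ₗ[ℝ] TangentSpace (𝓡 d) (riemExp x v),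
      (∀ u, expTransport x v u = T u) ∧ (∀ u, ‖T u‖ = ‖u‖) ∧
      ∀ (L : ℝ) (f : M → ℝ), IsGSmooth d L f →
        ‖riemGrad f (riemExp x v) - T (riemGrad f x)‖ ≤ L * ‖v‖ ∧
        f (riemExp x v) ≤ f x + inner ℝ (riemGrad (d := d) f x) v + L / 2 * ‖v‖ ^ 2 := by
  have h := hM x v
  have hg : geodesic x v = h.choose := dif_pos h
  have hspec : IsGeodesic (d := d) (geodesic x v) ∧
      (⟨geodesic x v 0, velocity (geodesic x v) 0⟩ : TangentBundle (𝓡 d) M) = ⟨x, v⟩ := by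
    rw [hg]; exact h.choose_spec
  exact hspec.1.exists_transport hspec.2

end Transport

/-! ### Lower integrals over product measures. -/

section LowerIntegral

/-- The integral of `f` is attained by a measurable minorant, to which Tonelli applies. No
measurability of `f` is required. -/
lemma lintegral_prod_le {α β : Type*} [MeasurableSpace α] [MeasurableSpace β] (μ : Measure α)
    (ν : Measure β) [SFinite ν] (f : α × β → ℝ≥0∞) :
    ∫⁻ z, f z ∂(μ.prod ν) ≤ ∫⁻ x, ∫⁻ y, f (x, y) ∂ν ∂μ := by
  obtain ⟨g, hg, hgf, he⟩ := exists_measurable_le_lintegral_eq (μ.prod ν) f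
  rw [he, lintegral_prod _ hg.aemeasurable]
  exact lintegral_mono fun x => lintegral_mono fun y => hgf (x, y)

lemma lintegral_pi_insertNth_le {α : Type*} [MeasurableSpace α] (μ : Measure α)
    [IsProbabilityMeasure μ] {k : ℕ} (i : Fin (k + 1)) (F : (Fin (k + 1) → α) → ℝ≥0∞) :
    ∫⁻ r, F r ∂(Measure.pi fun _ => μ)
      ≤ ∫⁻ a, ∫⁻ r, F (i.insertNth a r) ∂(Measure.pi fun _ => μ) ∂μ := by
  have h := (measurePreserving_piFinSuccAbove (fun _ : Fin (k + 1) => μ) i).symm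
  rw [← h.map_eq, lintegral_map_equiv]
  exact lintegral_prod_le _ _ _

lemma lintegral_pi_eval_le {α : Type*} [MeasurableSpace α] (μ : Measure α)
    [IsProbabilityMeasure μ] {n : ℕ} (i : Fin n) (g : α → ℝ≥0∞) :
    ∫⁻ r, g (r i) ∂(Measure.pi fun _ : Fin n => μ) ≤ ∫⁻ a, g a ∂μ := by
  obtain ⟨k, rfl⟩ := Nat.exists_eq_add_one.2 i.pos
  refine (lintegral_pi_insertNth_le μ i _).trans ?_
  simp

lemma lintegral_bernoulliMeasure (p : unitInterval) (g : Bool → ℝ≥0∞) :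
    ∫⁻ b, g b ∂(bernoulliMeasure true false p)
      = ENNReal.ofReal p * g true + ENNReal.ofReal (1 - p) * g false := by
  have h1 : ((unitInterval.toNNReal p : NNReal) : ℝ≥0∞) = ENNReal.ofReal p := by
    rw [ENNReal.ofReal]; congr 1; ext; simp [p.2.1]
  have h2 : ((unitInterval.toNNReal (unitInterval.symm p) : NNReal) : ℝ≥0∞)
      = ENNReal.ofReal (1 - p) := by
    rw [ENNReal.ofReal]; congr 1; ext; simp [p.2.2]
  rw [bernoulliMeasure_def, lintegral_add_measure, lintegral_smul_measure, lintegral_smul_measure,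
    lintegral_dirac, lintegral_dirac, ← h1, ← h2]
  rfl

lemma lintegral_uniformOn_univ {K : ℕ} (g : Fin K → ℝ≥0∞) :
    ∫⁻ k, g k ∂(uniformOn (Set.univ : Set (Fin K))) = (K : ℝ≥0∞)⁻¹ * ∑ k, g k := by
  rw [uniformOn, ProbabilityTheory.cond, Measure.restrict_univ, lintegral_smul_measure,
    lintegral_count, tsum_fintype, Measure.count_univ]
  simp

end LowerIntegral

/-! ### Random recursions and potentials. -/

section Run

variable {σ R : Type*}

/-- The state after `k` rounds of a random recursion started at a given state. -/
def runFrom (next : σ → R → σ) : (k : ℕ) → σ → (Fin k → R) → σ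
  | 0, st, _ => st
  | k + 1, st, r => runFrom next k (next st (r 0)) (Fin.tail r)

/-- `iter` adds rounds at the end, whereas the potential argument conditions on the first round;
this reconciles the two. -/
lemma runFrom_succ_last (next : σ → R → σ) (k : ℕ) (st : σ) (r : Fin (k + 1) → R) :
    runFrom next (k + 1) st r = next (runFrom next k st (Fin.init r)) (r (Fin.last k)) := by
  induction k generalizing st with
  | zero => rfl
  | succ k ih =>
    rw [runFrom, ih]
    rfl

/-- Expected accumulated cost of a random recursion, bounded by a potential. No measurability is
needed, since the lower integral over the whole run is at most the iterated one. -/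
lemma lintegral_sum_runFrom_le [MeasurableSpace R] (μ : Measure R) [IsProbabilityMeasure μ]
    (next : σ → R → σ) (c : σ → R → ℝ≥0∞) (Φ : ℕ → σ → ℝ≥0∞)
    (hstep : ∀ K st, ∫⁻ a, (c st a + Φ K (next st a)) ∂μ ≤ Φ (K + 1) st) (K : ℕ) (st : σ) :
    ∫⁻ r, ∑ k : Fin K, c (runFrom next k st fun j => r (Fin.castLE k.is_lt.le j)) (r k)
      ∂(Measure.pi fun _ : Fin K => μ) ≤ Φ K st := by
  induction K generalizing st with
  | zero => simp
  | succ K ih =>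
    -- Once the first round is fixed, the rest is a run of `K` rounds from the new state; the index
    -- of `Φ` counts the rounds left.
    refine (lintegral_pi_insertNth_le μ 0 _).trans (le_trans ?_ (hstep K st))
    refine lintegral_mono fun a => ?_
    simp only [Fin.insertNth_zero']
    calc ∫⁻ r : Fin K → R, ∑ k : Fin (K + 1),
          c (runFrom next k st fun j => (Fin.cons a r : Fin (K + 1) → R) (Fin.castLE k.is_lt.le j))
            ((Fin.cons a r : Fin (K + 1) → R) k) ∂(Measure.pi fun _ => μ)
        = ∫⁻ r : Fin K → R, (c st a + ∑ k : Fin K,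
            c (runFrom next k (next st a) fun j => r (Fin.castLE k.is_lt.le j)) (r k))
            ∂(Measure.pi fun _ => μ) := by
          refine lintegral_congr fun r => ?_
          rw [Fin.sum_univ_succ]
          rfl
      _ = c st a + ∫⁻ r : Fin K → R, ∑ k : Fin K,
            c (runFrom next k (next st a) fun j => r (Fin.castLE k.is_lt.le j)) (r k)
            ∂(Measure.pi fun _ => μ) := by
          rw [lintegral_add_left measurable_const]; simp
      _ ≤ c st a + Φ K (next st a) := by gcongr; exact ih _

end Run

/-! ### Second moments of sums of independent centred vectors. -/

section SecondMoment

variable {S : Type*} [MeasurableSpace S] {ν : Measure S} [IsProbabilityMeasure ν]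
  {H : Type*} [NormedAddCommGroup H] [InnerProductSpace ℝ H] [CompleteSpace H]

lemma enorm_sq_eq_ofReal {H : Type*} [SeminormedAddCommGroup H] (x : H) :
    ‖x‖ₑ ^ 2 = ENNReal.ofReal (‖x‖ ^ 2) := by
  rw [← ofReal_norm, ENNReal.ofReal_pow (norm_nonneg _)]

lemma memLp_two_of_lintegral_le {Z : S → H} (hZ : AEStronglyMeasurable Z ν) {v : ℝ}
    (hv : ∫⁻ s, ‖Z s‖ₑ ^ 2 ∂ν ≤ ENNReal.ofReal v) : MemLp Z 2 ν := by
  refine ⟨hZ, ?_⟩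
  rw [eLpNorm_lt_top_iff_lintegral_rpow_enorm_lt_top (by norm_num) (by norm_num)]
  simpa using hv.trans_lt ENNReal.ofReal_lt_top

/-- The second moment of a shifted centered random vector. -/
lemma lintegral_enorm_add_sq_le {Z : S → H} (hZ : AEStronglyMeasurable Z ν)
    (h0 : ∫ s, Z s ∂ν = 0) {v : ℝ} (hv0 : 0 ≤ v)
    (hv : ∫⁻ s, ‖Z s‖ₑ ^ 2 ∂ν ≤ ENNReal.ofReal v) (a : H) :
    ∫⁻ s, ‖a + Z s‖ₑ ^ 2 ∂ν ≤ ENNReal.ofReal (‖a‖ ^ 2 + v) := by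
  have hL := memLp_two_of_lintegral_le hZ hv
  have hint : Integrable Z ν := hL.integrable (by norm_num)
  have hsq : Integrable (fun s => ‖Z s‖ ^ 2) ν := hL.integrable_norm_pow (by norm_num)
  have hin : Integrable (fun s => inner ℝ a (Z s)) ν := hint.const_inner a
  have hexp : ∀ s, ‖a + Z s‖ ^ 2 = ‖a‖ ^ 2 + 2 * inner ℝ a (Z s) + ‖Z s‖ ^ 2 := fun s =>
    norm_add_sq_real a (Z s)
  have hlin : Integrable (fun s => ‖a‖ ^ 2 + 2 * inner ℝ a (Z s)) ν :=
    (integrable_const _).add (hin.const_mul 2)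
  have hsum : Integrable (fun s => ‖a‖ ^ 2 + 2 * inner ℝ a (Z s) + ‖Z s‖ ^ 2) ν :=
    hlin.add hsq
  have hZv : ∫ s, ‖Z s‖ ^ 2 ∂ν ≤ v := by
    rw [integral_eq_lintegral_of_nonneg_ae (Filter.Eventually.of_forall fun s => by positivity)
      hsq.aestronglyMeasurable]
    refine ENNReal.toReal_le_of_le_ofReal hv0 ?_
    simpa only [enorm_sq_eq_ofReal] using hv
  simp only [enorm_sq_eq_ofReal, hexp]
  rw [← ofReal_integral_eq_lintegral_ofReal hsum
    (Filter.Eventually.of_forall fun s => (sq_nonneg ‖a + Z s‖).trans_eq (hexp s))]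
  refine ENNReal.ofReal_le_ofReal ?_
  rw [integral_add hlin hsq,
    integral_add (integrable_const _) (hin.const_mul 2), integral_const_mul,
    integral_inner hint, h0]
  simpa using hZv

/-- The second moment of a sum of independent centered random vectors. -/
lemma lintegral_enorm_add_sum_sq_le {n : ℕ} {Z : Fin n → S → H}
    (hZ : ∀ i, AEStronglyMeasurable (Z i) ν) (h0 : ∀ i, ∫ s, Z i s ∂ν = 0) {v : Fin n → ℝ}
    (hv0 : ∀ i, 0 ≤ v i) (hv : ∀ i, ∫⁻ s, ‖Z i s‖ₑ ^ 2 ∂ν ≤ ENNReal.ofReal (v i)) (a : H) :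
    ∫⁻ s, ‖a + ∑ i, Z i (s i)‖ₑ ^ 2 ∂(Measure.pi fun _ : Fin n => ν)
      ≤ ENNReal.ofReal (‖a‖ ^ 2 + ∑ i, v i) := by
  induction n generalizing a with
  | zero => 
    simp only [Finset.univ_eq_empty, Finset.sum_empty, add_zero, lintegral_const, measure_univ,
      mul_one, enorm_sq_eq_ofReal, le_refl]
  | succ n ih =>
    -- Given the first vector, the induction hypothesis applies with shift `a + Z 0 s₀`; hence the
    -- arbitrary shift in the statement.
    refine (lintegral_pi_insertNth_le ν 0 _).trans ?_
    simp only [Fin.insertNth_zero', Fin.sum_univ_succ, Fin.cons_zero, Fin.cons_succ]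
    have hs : 0 ≤ ∑ i : Fin n, v i.succ := Finset.sum_nonneg fun i _ => hv0 _
    calc ∫⁻ s₀, ∫⁻ s : Fin n → S, ‖a + (Z 0 s₀ + ∑ i, Z i.succ (s i))‖ₑ ^ 2
            ∂(Measure.pi fun _ => ν) ∂ν
        ≤ ∫⁻ s₀, (‖a + Z 0 s₀‖ₑ ^ 2 + ENNReal.ofReal (∑ i : Fin n, v i.succ)) ∂ν := by
          refine lintegral_mono fun s₀ => ?_
          simp only [← add_assoc]
          refine (ih (fun i => hZ i.succ) (fun i => h0 i.succ) (fun i => hv0 i.succ)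
            (fun i => hv i.succ) (a + Z 0 s₀)).trans_eq ?_
          rw [ENNReal.ofReal_add (by positivity) hs, enorm_sq_eq_ofReal]
      _ = ∫⁻ s₀, ‖a + Z 0 s₀‖ₑ ^ 2 ∂ν + ENNReal.ofReal (∑ i : Fin n, v i.succ) := by
          rw [lintegral_add_right _ measurable_const]; simp
      _ ≤ ENNReal.ofReal (‖a‖ ^ 2 + v 0) + ENNReal.ofReal (∑ i : Fin n, v i.succ) := by
          gcongr
          exact lintegral_enorm_add_sq_le (hZ 0) (h0 0) (hv0 0) (hv 0) a
      _ = ENNReal.ofReal (‖a‖ ^ 2 + (v 0 + ∑ i : Fin n, v i.succ)) := by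
          rw [← ENNReal.ofReal_add (add_nonneg (by positivity) (hv0 0)) hs, add_assoc]

end SecondMoment

/-! ### Measurability and density of the compressors. -/

section Compressor

variable {d : ℕ} {M : Type*} [TopologicalSpace M]
  [ChartedSpace (EuclideanSpace ℝ (Fin d)) M] [IsManifold (𝓡 d) ∞ M]
  [RiemannianBundle (fun x : M => TangentSpace (𝓡 d) x)]
  {S : Type*} [MeasurableSpace S] {ν : Measure S} {ωQ : ℝ}

/-- The inclusion of a fibre in the tangent bundle is inducing, so the Borel sets of the fibre are
the traces of those of the bundle. -/
lemma IsUnbiasedCompressor.stronglyMeasurable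
    {q : S → ∀ x : M, TangentSpace (𝓡 d) x → TangentSpace (𝓡 d) x}
    (hq : IsUnbiasedCompressor ν ωQ q) (x : M) (y : TangentSpace (𝓡 d) x) :
    StronglyMeasurable (fun s => q s x y) := by
  let _ : MeasurableSpace (TangentSpace (𝓡 d) x) := borel _
  have : BorelSpace (TangentSpace (𝓡 d) x) := ⟨rfl⟩
  have : SecondCountableTopology (TangentSpace (𝓡 d) x) :=
    inferInstanceAs (SecondCountableTopology (EuclideanSpace ℝ (Fin d)))
  let _ : MeasurableSpace (TangentBundle (𝓡 d) M) := borel _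
  have h1 : Measurable (fun s => (⟨x, q s x y⟩ : TangentBundle (𝓡 d) M)) :=
    hq.measurable.comp (measurable_id.prodMk measurable_const : Measurable fun s : S =>
      (s, (⟨x, y⟩ : TangentBundle (𝓡 d) M)))
  have h2 : borel (TangentSpace (𝓡 d) x)
      = (borel (TangentBundle (𝓡 d) M)).comap (TotalSpace.mk x) := by
    rw [← borel_comap, ← (FiberBundle.totalSpaceMk_isInducing (EuclideanSpace ℝ (Fin d))
      (fun x : M => TangentSpace (𝓡 d) x) x).eq_induced]
  have h3 : Measurable (fun s => q s x y) := by
    intro A hA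
    have hA' : MeasurableSet[borel (TangentSpace (𝓡 d) x)] A := hA
    rw [h2] at hA'
    obtain ⟨B, hB, rfl⟩ := hA'
    exact h1 hB
  exact h3.stronglyMeasurable

/-- The supremum is at most `d`, so `toReal` loses nothing. -/
lemma expectedDensity_eq [IsProbabilityMeasure ν] {n : ℕ} (b : MeasurableFrame d M)
    (Q : Fin n → S → ∀ x : M, TangentSpace (𝓡 d) x → TangentSpace (𝓡 d) x) :
    ENNReal.ofReal (expectedDensity b ν Q) = ⨆ (i : Fin n) (x : M) (y : TangentSpace (𝓡 d) x),
      ∫⁻ s, (b.nnz (Q i s x y) : ℝ≥0∞) ∂ν := by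
  refine ENNReal.ofReal_toReal (ne_top_of_le_ne_top (ENNReal.natCast_ne_top d) ?_)
  refine iSup_le fun i => iSup_le fun x => iSup_le fun y => ?_
  calc ∫⁻ s, (b.nnz (Q i s x y) : ℝ≥0∞) ∂ν ≤ ∫⁻ _, (d : ℝ≥0∞) ∂ν := by
        refine lintegral_mono fun s => ?_
        have h : b.nnz (Q i s x y) ≤ d := (Finset.card_le_univ _).trans_eq (Fintype.card_fin d)
        exact Nat.cast_le.2 h
    _ = d := by simp

lemma lintegral_nnz_le [IsProbabilityMeasure ν] {n : ℕ} (b : MeasurableFrame d M)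
    (Q : Fin n → S → ∀ x : M, TangentSpace (𝓡 d) x → TangentSpace (𝓡 d) x) (i : Fin n) (x : M)
    (y : TangentSpace (𝓡 d) x) :
    ∫⁻ s, (b.nnz (Q i s x y) : ℝ≥0∞) ∂ν ≤ ENNReal.ofReal (expectedDensity b ν Q) := by
  rw [expectedDensity_eq]
  exact le_iSup_of_le i (le_iSup_of_le x (le_iSup_of_le y le_rfl))

/-- With density zero, a nonzero basis vector would be compressed to `0` almost surely, against
unbiasedness. This gives `p > 0`. -/
lemma expectedDensity_pos [IsProbabilityMeasure ν] {n : ℕ} (hd : 0 < d) (hn : 0 < n)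
    (b : MeasurableFrame d M)
    (Q : Fin n → S → ∀ x : M, TangentSpace (𝓡 d) x → TangentSpace (𝓡 d) x)
    (hQ : ∀ i, IsUnbiasedCompressor ν ωQ (Q i)) (x : M) : 0 < expectedDensity b ν Q := by
  by_contra hneg
  set i : Fin n := ⟨0, hn⟩
  set y := b.basis x ⟨0, hd⟩
  have hy : y ≠ 0 := (b.basis x).ne_zero _
  have h0 := lintegral_nnz_le (ν := ν) b Q i x y
  rw [ENNReal.ofReal_of_nonpos (not_lt.1 hneg)] at h0
  have hm : MeasurableSet (Function.support fun s => Q i s x y) :=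
    ((hQ i).stronglyMeasurable x y).measurableSet_support
  have h1 : ν (Function.support fun s => Q i s x y) = 0 := by
    refine le_antisymm ?_ zero_le
    rw [← lintegral_indicator_one hm]
    refine le_trans (lintegral_mono fun s => ?_) h0
    by_cases hs : s ∈ Function.support fun s => Q i s x y
    · rw [Set.indicator_of_mem hs, Pi.one_apply]
      have : b.nnz (Q i s x y) ≠ 0 := by
        rw [MeasurableFrame.nnz, Finset.card_ne_zero, Finsupp.support_nonempty_iff]
        simpa using hs
      exact Nat.one_le_cast.2 (Nat.one_le_iff_ne_zero.2 this)
    · rw [Set.indicator_of_notMem hs]; exact zero_le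
  have h2 : (fun s => Q i s x y) =ᵐ[ν] 0 := by
    rw [Filter.EventuallyEq, ae_iff]
    exact h1
  have h3 := (hQ i).unbiased x y
  rw [integral_congr_ae h2] at h3
  exact hy (by simpa using h3.symm)

end Compressor

/-! ### One round: the error of the estimator and the objective. -/

section Step

variable {d : ℕ} {M : Type*} [TopologicalSpace M]
  [ChartedSpace (EuclideanSpace ℝ (Fin d)) M] [IsManifold (𝓡 d) ∞ M]
  [RiemannianBundle (fun x : M => TangentSpace (𝓡 d) x)]
  [IsContMDiffRiemannianBundle (𝓡 d) ∞ (EuclideanSpace ℝ (Fin d))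
          (fun x : M => TangentSpace (𝓡 d) x)]
  {S : Type*} [MeasurableSpace S] {ν : Measure S} [IsProbabilityMeasure ν] {n : ℕ}
  {f : Fin n → M → ℝ} {L ωQ η : ℝ}
  {Q : Fin n → S → ∀ x : M, TangentSpace (𝓡 d) x → TangentSpace (𝓡 d) x}

lemma mvfderiv_objective (hf : ∀ i, MDifferentiable (𝓡 d) 𝓘(ℝ, ℝ) (f i)) (x : M)
    (v : TangentSpace (𝓡 d) x) :
    mvfderiv (𝓡 d) (objective f) x v = (n : ℝ)⁻¹ * ∑ i, mvfderiv (𝓡 d) (f i) x v := by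
  have h1 := HasMFDerivAt.sum (t := Finset.univ) (fun i _ => (hf i x).hasMFDerivAt)
  have h2 := h1.const_smul (n : ℝ)⁻¹
  have h3 : objective f = (n : ℝ)⁻¹ • ∑ i, f i := by
    ext x
    simp [objective, div_eq_inv_mul]
  rw [← h3] at h2
  have h4 := congrArg (fun T => T v) h2.mfderiv
  refine h4.trans ?_
  change ((n : ℝ)⁻¹ • ∑ i, (mvfderiv (𝓡 d) (f i) x : TangentSpace (𝓡 d) x →L[ℝ] ℝ)) v = _
  rw [smul_apply, sum_apply, smul_eq_mul]

lemma riemGrad_objective (hf : ∀ i, MDifferentiable (𝓡 d) 𝓘(ℝ, ℝ) (f i)) (x : M) :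
    riemGrad (d := d) (objective f) x = (n : ℝ)⁻¹ • ∑ i, riemGrad (d := d) (f i) x := by
  refine ext_inner_right ℝ fun v => ?_
  rw [inner_riemGrad, mvfderiv_objective hf, real_inner_smul_left, sum_inner]
  simp only [inner_riemGrad]

lemma State.exists_transport (hM : GeodesicallyComplete d M) (η : ℝ) (st : State d M n) :
    ∃ T : TangentSpace (𝓡 d) st.point →ₗ[ℝ] TangentSpace (𝓡 d) (st.next η),
      (∀ u, st.transport η u = T u) ∧ (∀ u, ‖T u‖ = ‖u‖) ∧
      ∀ (L : ℝ) (f : M → ℝ), IsGSmooth d L f →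
        ‖riemGrad f (st.next η) - T (riemGrad f st.point)‖ ≤ L * ‖st.stepVec η‖ ∧
        f (st.next η) ≤ f st.point + inner ℝ (riemGrad f st.point) (st.stepVec η)
          + L / 2 * ‖st.stepVec η‖ ^ 2 :=
  exists_expTransport hM st.point (st.stepVec η)

/-- The average `g^k` of the estimators. -/
def State.avg (st : State d M n) : TangentSpace (𝓡 d) st.point := (n : ℝ)⁻¹ • ∑ i, st.est i

/-- The error of the averaged estimator. -/
def State.err (f : Fin n → M → ℝ) (st : State d M n) : TangentSpace (𝓡 d) st.point :=
  st.avg - riemGrad (objective f) st.point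

lemma err_step_true (hf : ∀ i, MDifferentiable (𝓡 d) 𝓘(ℝ, ℝ) (f i)) (st : State d M n)
    (s : Fin n → S) : (step f Q η st (true, s)).err f = 0 := by
  rw [State.err, riemGrad_objective hf, sub_eq_zero]
  rfl

/-- By linearity of `T`, each worker's new error is its transported old error plus the centred
compression error of its gradient difference. -/
lemma enorm_err_step_false (hf : ∀ i, MDifferentiable (𝓡 d) 𝓘(ℝ, ℝ) (f i)) (st : State d M n)
    (s : Fin n → S)
    {T : TangentSpace (𝓡 d) st.point →ₗ[ℝ] TangentSpace (𝓡 d) (st.next η)}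
    (hT : ∀ u, st.transport η u = T u) :
    ‖(step f Q η st (false, s)).err f‖ₑ
      = ‖T (st.err f) + ∑ i, (n : ℝ)⁻¹ •
        (Q i (s i) (st.next η) (st.gradDiff f η i) - st.gradDiff f η i)‖ₑ := by
  have h1 : (step f Q η st (false, s)).err f
      = (n : ℝ)⁻¹ • ∑ i, (st.transport η (st.est i) + Q i (s i) (st.next η) (st.gradDiff f η i))
        - riemGrad (d := d) (objective f) (st.next η) := rfl
  rw [h1]
  congr 1
  rw [State.err, State.avg, riemGrad_objective hf, riemGrad_objective hf, map_sub, map_smul,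
    map_smul, map_sum, map_sum, ← Finset.smul_sum, ← smul_sub, ← smul_sub, ← smul_add,
    ← Finset.sum_sub_distrib, ← Finset.sum_sub_distrib, ← Finset.sum_add_distrib]
  congr 1
  refine Finset.sum_congr rfl fun i _ => ?_
  rw [State.gradDiff, hT, hT]
  abel

/-- One round contracts the expected squared error of the estimator. -/
lemma lintegral_err_step_le (hM : GeodesicallyComplete d M) (hn : 0 < n)
    (hf : ∀ i, IsGSmooth d L (f i))
    (hQ : ∀ i, IsUnbiasedCompressor ν ωQ (Q i)) (p : unitInterval) (st : State d M n) :
    ∫⁻ r, ‖(step f Q η st r).err f‖ₑ ^ 2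
        ∂((bernoulliMeasure true false p).prod (Measure.pi fun _ => ν))
      ≤ ENNReal.ofReal ((1 - p) * (‖st.err f‖ ^ 2 + ωQ / n * (L * ‖st.stepVec η‖) ^ 2)) := by
  obtain ⟨T, hT, hTn, hTf⟩ := st.exists_transport hM η
  have hfd : ∀ i, MDifferentiable (𝓡 d) 𝓘(ℝ, ℝ) (f i) := fun i => (hf i).1
  have hω : 0 ≤ ωQ := (hQ ⟨0, hn⟩).nonneg
  have hnR : (0 : ℝ) < n := by exact_mod_cast hn
  have : FiniteDimensional ℝ (TangentSpace (𝓡 d) (st.next η)) :=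
    inferInstanceAs (FiniteDimensional ℝ (EuclideanSpace ℝ (Fin d)))
  have : CompleteSpace (TangentSpace (𝓡 d) (st.next η)) :=
    FiniteDimensional.complete ℝ (TangentSpace (𝓡 d) (st.next η))
  have hΔ : ∀ i, ‖st.gradDiff f η i‖ ≤ L * ‖st.stepVec η‖ := by
    intro i
    have := (hTf L (f i) (hf i)).1
    rw [← hT] at this
    exact this
  have hfalse : ∫⁻ s, ‖(step f Q η st (false, s)).err f‖ₑ ^ 2 ∂(Measure.pi fun _ => ν)
      ≤ ENNReal.ofReal (‖st.err f‖ ^ 2 + ωQ / n * (L * ‖st.stepVec η‖) ^ 2) := by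
    simp only [enorm_err_step_false hfd st _ hT]
    refine (lintegral_enorm_add_sum_sq_le (ν := ν)
      (Z := fun i s => (n : ℝ)⁻¹ •
        (Q i s (st.next η) (st.gradDiff f η i) - st.gradDiff f η i))
      -- Each worker contributes variance with factor `n⁻²`; the `n` terms sum to the factor `ωQ /
      -- n`.
      (v := fun i => (n : ℝ)⁻¹ ^ 2 * (ωQ * ‖st.gradDiff f η i‖ ^ 2)) ?_ ?_ ?_ ?_ _).trans ?_
    · intro i
      exact ((((hQ i).stronglyMeasurable (st.next η) (st.gradDiff f η i)).sub stronglyMeasurable_const).const_smul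
        (n : ℝ)⁻¹).aestronglyMeasurable
    · intro i
      have hint : Integrable (fun s => Q i s (st.next η) (st.gradDiff f η i)) ν := by
        have h := (memLp_two_of_lintegral_le (((hQ i).stronglyMeasurable (st.next η)
          (st.gradDiff f η i)).sub stronglyMeasurable_const).aestronglyMeasurable
          ((hQ i).variance _ _)).integrable (by norm_num)
        simpa using h.add (integrable_const (st.gradDiff f η i))
      rw [integral_smul, integral_sub hint (integrable_const _), (hQ i).unbiased]
      simp
    · intro i; positivity
    · intro i
      simp only [enorm_smul, mul_pow]
      rw [lintegral_const_mul' _ _ (by simp), ENNReal.ofReal_mul (by positivity)]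
      gcongr
      · rw [enorm_sq_eq_ofReal]; simp
      · exact (hQ i).variance _ _
    · refine ENNReal.ofReal_le_ofReal ?_
      rw [hTn]
      gcongr
      calc ∑ i, (n : ℝ)⁻¹ ^ 2 * (ωQ * ‖st.gradDiff f η i‖ ^ 2)
          ≤ ∑ _i : Fin n, (n : ℝ)⁻¹ ^ 2 * (ωQ * (L * ‖st.stepVec η‖) ^ 2) := by
            gcongr with i; exact hΔ i
        _ = ωQ / n * (L * ‖st.stepVec η‖) ^ 2 := by
            rw [Finset.sum_const, Finset.card_univ, Fintype.card_fin, nsmul_eq_mul]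
            field_simp
  refine (lintegral_prod_le _ _ _).trans ?_
  rw [lintegral_bernoulliMeasure, ENNReal.ofReal_mul (by linarith [p.2.2])]
  have htrue : ∫⁻ s, ‖(step f Q η st (true, s)).err f‖ₑ ^ 2 ∂(Measure.pi fun _ => ν) = 0 := by
    simp only [err_step_true hfd]; simp
  rw [htrue, mul_zero, zero_add]
  gcongr

lemma objective_next_le (hM : GeodesicallyComplete d M) (hn : 0 < n)
    (hf : ∀ i, IsGSmooth d L (f i)) (st : State d M n) :
    objective f (st.next η) ≤ objective f st.point
      + inner ℝ (riemGrad (objective f) st.point) (st.stepVec η) + L / 2 * ‖st.stepVec η‖ ^ 2 := by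
  obtain ⟨T, -, -, hTf⟩ := st.exists_transport hM η
  have hnR : (0 : ℝ) < n := by exact_mod_cast hn
  rw [riemGrad_objective (fun i => (hf i).1), real_inner_smul_left, sum_inner]
  have h := Finset.sum_le_sum (s := Finset.univ) fun i _ => (hTf L (f i) (hf i)).2
  rw [Finset.sum_add_distrib, Finset.sum_add_distrib, Finset.sum_const, Finset.card_univ,
    Fintype.card_fin, nsmul_eq_mul] at h
  have h' : (∑ i, f i (st.next η)) / n ≤ (∑ i, f i st.point
      + ∑ i, inner ℝ (riemGrad (d := d) (f i) st.point) (st.stepVec η)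
      + n * (L / 2 * ‖st.stepVec η‖ ^ 2)) / n := by
    gcongr
  refine h'.trans_eq ?_
  rw [objective]
  field_simp

end Step

/-! ### The Lyapunov argument, the communication cost and the number of rounds. -/

section Convergence

variable {d : ℕ} {M : Type*} [TopologicalSpace M]
  [ChartedSpace (EuclideanSpace ℝ (Fin d)) M] [IsManifold (𝓡 d) ∞ M]
  [RiemannianBundle (fun x : M => TangentSpace (𝓡 d) x)]
  [IsContMDiffRiemannianBundle (𝓡 d) ∞ (EuclideanSpace ℝ (Fin d))
          (fun x : M => TangentSpace (𝓡 d) x)]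
  {S : Type*} [MeasurableSpace S] {ν : Measure S} [IsProbabilityMeasure ν] {n : ℕ}
  {f : Fin n → M → ℝ} {L ωQ η fstar : ℝ}
  {Q : Fin n → S → ∀ x : M, TangentSpace (𝓡 d) x → TangentSpace (𝓡 d) x}

/-- The Lyapunov function of the method, scaled by `2 / η`. -/
def potential (f : Fin n → M → ℝ) (fstar η p : ℝ) (st : State d M n) : ℝ :=
  2 / η * (objective f st.point - fstar) + 1 / p * ‖st.err f‖ ^ 2

/-- The stepsize is small enough for the descent of the potential. -/
lemma stepsize_condition (hL : 0 < L) {B : ℝ} (hB : 0 ≤ B) (hη : η = 1 / (L * (1 + B))) :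
    0 < η ∧ L * η + B ^ 2 * (L * η) ^ 2 ≤ 1 := by
  have h1 : 0 < 1 + B := by linarith
  have h2 : L * η = 1 / (1 + B) := by rw [hη]; field_simp
  refine ⟨by rw [hη]; positivity, ?_⟩
  rw [h2, div_pow, mul_div_assoc', div_add_div _ _ h1.ne' (by positivity), div_le_one (by positivity)]
  -- Up to a factor `1 + B`, the claim is `1 + B + B² ≤ (1 + B)²`.
  nlinarith [mul_nonneg hB (sq_nonneg (1 + B))]

/-- Here `N = ‖g‖`, `G = ‖∇f‖`, `I = ⟨∇f, g⟩`, `E` is the squared error and `w = ω/n`. The weight `2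
/ η` turns `-ηI` into `-2I`, the weight `1 / p` leaves a spare `-E`, and `G² - 2I - E = -N²` absorbs
the remaining terms by `hcond`. -/
lemma potential_arith {p w N G I E F F' : ℝ} (hη : 0 < η) (hp : 0 < p)
    (hcond : L * η + (1 - p) / p * w * (L * η) ^ 2 ≤ 1)
    (hE : E = N ^ 2 - 2 * I + G ^ 2) (hF : F' ≤ F + -(η * I) + L / 2 * (η * N) ^ 2) :
    G ^ 2 + 2 / η * F' + 1 / p * ((1 - p) * (E + w * (L * (η * N)) ^ 2))
      ≤ 2 / η * F + 1 / p * E := by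
  have h1 : 2 / η * F' ≤ 2 / η * F - 2 * I + L * η * N ^ 2 := by
    have : 2 / η * F' ≤ 2 / η * (F + -(η * I) + L / 2 * (η * N) ^ 2) := by gcongr
    refine this.trans_eq ?_
    field_simp
    ring
  have h2 : 1 / p * ((1 - p) * (E + w * (L * (η * N)) ^ 2))
      = 1 / p * E - E + (1 - p) / p * w * (L * η) ^ 2 * N ^ 2 := by
    field_simp
  rw [h2]
  nlinarith [mul_le_mul_of_nonneg_right hcond (sq_nonneg N)]

/-- One round decreases the potential in expectation. -/
lemma lintegral_potential_step_le (hM : GeodesicallyComplete d M) (hn : 0 < n) (hL : 0 < L)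
    (hf : ∀ i, IsGSmooth d L (f i)) (hstar : ∀ x, fstar ≤ objective f x)
    (hQ : ∀ i, IsUnbiasedCompressor ν ωQ (Q i)) (p : unitInterval) (hp : 0 < (p : ℝ))
    (hη : η = 1 / (L * (1 + √((1 - p) / p * (ωQ / n))))) (st : State d M n) :
    ∫⁻ r, (‖riemGrad (d := d) (objective f) st.point‖ₑ ^ 2
        + ENNReal.ofReal (potential f fstar η p (step f Q η st r)))
        ∂((bernoulliMeasure true false p).prod (Measure.pi fun _ => ν))
      ≤ ENNReal.ofReal (potential f fstar η p st) := by
  have hω : 0 ≤ ωQ := (hQ ⟨0, hn⟩).nonneg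
  have hp1 : (0 : ℝ) ≤ 1 - p := by linarith [p.2.2]
  have hw : 0 ≤ (1 - p) / p * (ωQ / n) := by positivity
  obtain ⟨hη0, hcond⟩ := stepsize_condition hL (Real.sqrt_nonneg _) hη
  rw [Real.sq_sqrt hw] at hcond
  -- The lower bound on the objective keeps the potential nonnegative, so `ENNReal.ofReal` does not
  -- truncate it.
  have hF0 : 0 ≤ 2 / η * (objective f (st.next η) - fstar) :=
    mul_nonneg (by positivity) (by linarith [hstar (st.next η)])
  -- The next point is determined by the state; only the error depends on the randomness of the
  -- round.
  have hsplit : ∀ r, ENNReal.ofReal (potential f fstar η p (step f Q η st r))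
      = ENNReal.ofReal (2 / η * (objective f (st.next η) - fstar))
        + ENNReal.ofReal (1 / p) * ‖(step f Q η st r).err f‖ₑ ^ 2 := by
    intro r
    rw [enorm_sq_eq_ofReal, ← ENNReal.ofReal_mul (by positivity),
      ← ENNReal.ofReal_add hF0 (by positivity)]
    rfl
  simp only [hsplit]
  rw [lintegral_add_left measurable_const, lintegral_add_left measurable_const,
    lintegral_const_mul' _ _ ENNReal.ofReal_ne_top, lintegral_const, lintegral_const]
  simp only [measure_univ, mul_one]
  have herr := lintegral_err_step_le (η := η) hM hn hf hQ p st
  refine le_trans (add_le_add_right (add_le_add_right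
    (mul_le_mul_right herr _) _) _) ?_
  rw [enorm_sq_eq_ofReal, ← ENNReal.ofReal_mul (by positivity),
    ← ENNReal.ofReal_add hF0 (by positivity), ← ENNReal.ofReal_add (by positivity) (by positivity)]
  refine ENNReal.ofReal_le_ofReal ?_
  have hstep : st.stepVec η = -(η • st.avg) := rfl
  have hnorm : ‖st.stepVec η‖ = η * ‖st.avg‖ := by
    rw [hstep, norm_neg, norm_smul, Real.norm_of_nonneg hη0.le]
  have hdesc := objective_next_le (η := η) hM hn hf st
  rw [hnorm, hstep, inner_neg_right, real_inner_smul_right] at hdesc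
  have hE : ‖st.err f‖ ^ 2 = ‖st.avg‖ ^ 2
      - 2 * inner ℝ (riemGrad (d := d) (objective f) st.point) st.avg
      + ‖riemGrad (d := d) (objective f) st.point‖ ^ 2 := by
    rw [State.err, norm_sub_sq_real, real_inner_comm]
  have := potential_arith (F := objective f st.point - fstar)
    (F' := objective f (st.next η) - fstar) hη0 hp hcond hE (by linarith)
  rw [hnorm, potential]
  linarith

/-- The state of the method as a random recursion. -/
lemma iter_eq_runFrom (x0 : M) (k : ℕ) (r : Fin k → Round S n) :
    iter f Q η x0 k r
      = runFrom (step f Q η) k ⟨x0, fun i => riemGrad (d := d) (f i) x0⟩ r := by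
  induction k with
  | zero => rfl
  | succ k ih => rw [iter, ih, runFrom_succ_last]

lemma iterOf_castSucc (x0 : M) {K : ℕ} (r : Fin K → Round S n) (k : Fin K) :
    iterOf f Q η x0 r k.castSucc
      = runFrom (step f Q η) k ⟨x0, fun i => riemGrad (d := d) (f i) x0⟩
        fun j => r (Fin.castLE k.is_lt.le j) :=
  iter_eq_runFrom x0 _ _

/-- The expected squared gradient norm at a uniformly chosen iterate. -/
lemma expectedSqGrad_le (hM : GeodesicallyComplete d M) (hn : 0 < n) (hL : 0 < L)
    (hf : ∀ i, IsGSmooth d L (f i)) (hstar : ∀ x, fstar ≤ objective f x)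
    (hQ : ∀ i, IsUnbiasedCompressor ν ωQ (Q i)) (p : unitInterval) (hp : 0 < (p : ℝ))
    (hη : η = 1 / (L * (1 + √((1 - p) / p * (ωQ / n))))) (x0 : M) (K : ℕ) :
    expectedSqGrad f Q η x0 p ν K
      ≤ (K : ℝ≥0∞)⁻¹ * ENNReal.ofReal (2 / η * (objective f x0 - fstar)) := by
  rcases Nat.eq_zero_or_pos K with rfl | hK
  · simp [expectedSqGrad]
  have : NeZero K := ⟨hK.ne'⟩
  refine (lintegral_prod_le _ _ _).trans ?_
  simp only [lintegral_uniformOn_univ]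
  rw [lintegral_const_mul' _ _ (by simp [hK.ne'])]
  gcongr
  have h := lintegral_sum_runFrom_le
    ((bernoulliMeasure true false p).prod (Measure.pi fun _ : Fin n => ν)) (step f Q η)
    (fun st _ => ‖riemGrad (d := d) (objective f) st.point‖ₑ ^ 2)
    (fun _ st => ENNReal.ofReal (potential f fstar η p st))
    (fun _ st => lintegral_potential_step_le hM hn hL hf hstar hQ p hp hη st) K
    ⟨x0, fun i => riemGrad (d := d) (f i) x0⟩
  -- The run starts from exact gradients, so the initial error is zero.
  have h0 : potential f fstar η p ⟨x0, fun i => riemGrad (d := d) (f i) x0⟩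
      = 2 / η * (objective f x0 - fstar) := by
    have : State.err f ⟨x0, fun i => riemGrad (d := d) (f i) x0⟩ = 0 := by
      rw [State.err, riemGrad_objective fun i => (hf i).1, sub_eq_zero]
      rfl
    rw [potential, this]
    simp
  rw [h0] at h
  refine le_trans (le_of_eq ?_) h
  exact lintegral_congr fun r => Finset.sum_congr rfl fun k _ => by rw [iterOf_castSucc]

/-- The expected communication cost of a worker. -/
lemma lintegral_commCost_le (hd : 0 < d) (b : MeasurableFrame d M) (p : unitInterval)
    (hp : (p : ℝ) = expectedDensity b ν Q / d) (x0 : M) (K : ℕ) (i : Fin n) :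
    ∫⁻ r, (commCost b f Q η x0 i r : ℝ≥0∞) ∂(runLaw p ν n K)
      ≤ d + K * ENNReal.ofReal (2 * expectedDensity b ν Q) := by
  have hρ : 0 ≤ expectedDensity b ν Q := ENNReal.toReal_nonneg
  have hdR : (0 : ℝ) < d := by exact_mod_cast hd
  set c : State d M n → Round S n → ℝ≥0∞ := fun st r =>
    if r.1 then (d : ℝ≥0∞) else b.nnz (Q i (r.2 i) _ (st.gradDiff f η i)) with hc
  have hround : ∀ st, ∫⁻ r, c st r ∂((bernoulliMeasure true false p).prod
      (Measure.pi fun _ : Fin n => ν)) ≤ ENNReal.ofReal (2 * expectedDensity b ν Q) := by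
    intro st
    refine (lintegral_prod_le _ _ _).trans ?_
    rw [lintegral_bernoulliMeasure]
    simp only [hc, if_true, Bool.false_eq_true, if_false, lintegral_const, measure_univ, mul_one]
    -- The choice `p = ρ / d` balances the two costs: full gradients cost `ρ` per round in
    -- expectation, compressed ones at most `ρ`.
    have h1 : ENNReal.ofReal p * d = ENNReal.ofReal (expectedDensity b ν Q) := by
      rw [hp, ← ENNReal.ofReal_natCast d, ← ENNReal.ofReal_mul (by positivity)]
      congr 1
      field_simp
    have h2 : ENNReal.ofReal (1 - p) * ∫⁻ s : Fin n → S,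
        (b.nnz (Q i (s i) _ (st.gradDiff f η i)) : ℝ≥0∞) ∂(Measure.pi fun _ => ν)
        ≤ 1 * ENNReal.ofReal (expectedDensity b ν Q) := by
      gcongr
      · exact ENNReal.ofReal_le_one.2 (by linarith [p.2.1])
      · exact (lintegral_pi_eval_le ν i fun s =>
          (b.nnz (Q i s _ (st.gradDiff f η i)) : ℝ≥0∞)).trans (lintegral_nnz_le b Q i _ _)
    rw [h1, two_mul, ENNReal.ofReal_add hρ hρ]
    rw [one_mul] at h2
    gcongr
  have h := lintegral_sum_runFrom_le
    ((bernoulliMeasure true false p).prod (Measure.pi fun _ : Fin n => ν)) (step f Q η) c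
    (fun K _ => K * ENNReal.ofReal (2 * expectedDensity b ν Q))
    (fun K st => by
      rw [lintegral_add_right _ measurable_const]
      simp only [lintegral_const, measure_univ, mul_one]
      rw [Nat.cast_succ, add_one_mul, add_comm]
      gcongr
      exact hround st) K
    ⟨x0, fun i => riemGrad (d := d) (f i) x0⟩
  calc ∫⁻ r, (commCost b f Q η x0 i r : ℝ≥0∞) ∂(runLaw p ν n K)
      = ∫⁻ r, (d + ∑ k : Fin K, c (runFrom (step f Q η) k
          ⟨x0, fun i => riemGrad (d := d) (f i) x0⟩ fun j => r (Fin.castLE k.is_lt.le j)) (r k))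
          ∂(runLaw p ν n K) := by
        refine lintegral_congr fun r => ?_
        rw [commCost, Nat.cast_add, Nat.cast_sum]
        refine congrArg _ (Finset.sum_congr rfl fun k _ => ?_)
        rw [iterOf_castSucc, Nat.cast_ite]
    _ = d + ∫⁻ r, ∑ k : Fin K, c (runFrom (step f Q η) k
          ⟨x0, fun i => riemGrad (d := d) (f i) x0⟩ fun j => r (Fin.castLE k.is_lt.le j)) (r k)
          ∂(runLaw p ν n K) := by
        have : IsProbabilityMeasure (runLaw p ν n K) := by
          unfold runLaw; infer_instance
        rw [lintegral_add_left measurable_const]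
        simp
    _ ≤ _ := by
        gcongr
        exact h

/-- The number of rounds that suffices, rounded to an integer. -/
lemma exists_nat_rounds (X : ℝ) :
    ∃ K₀ : ℕ, 1 ≤ K₀ ∧ (K₀ : ℝ) ≤ max 1 (2 * X) ∧ X ≤ K₀ := by
  rcases le_or_gt X 1 with h | h
  · exact ⟨1, le_rfl, by simp, by simpa using h⟩
  -- For `X > 1` rounding up costs at most a factor `2`, as `⌈X⌉ < X + 1 < 2X`.
  · refine ⟨⌈X⌉₊, Nat.one_le_ceil_iff.2 (by linarith), le_max_of_le_right ?_, Nat.le_ceil X⟩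
    linarith [Nat.ceil_lt_add_one (a := X) (by linarith)]

end Convergence

end RMarina

end

theorem corollary11 :
    ∃ C : ℝ, 0 < C ∧
      ∀ (d n : ℕ) (_ : 0 < d) (_ : 0 < n)
        (M : Type*) [TopologicalSpace M] [T2Space M] [SecondCountableTopology M]
        [ChartedSpace (EuclideanSpace ℝ (Fin d)) M] [IsManifold (𝓡 d) ∞ M]
        [RiemannianBundle (fun x : M => TangentSpace (𝓡 d) x)]
        [IsContMDiffRiemannianBundle (𝓡 d) ∞ (EuclideanSpace ℝ (Fin d))
          (fun x : M => TangentSpace (𝓡 d) x)]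
        (_ : RMarina.GeodesicallyComplete d M)
        -- the functions `f_i`, a lower bound `f^*` of `f`, the starting point
        (f : Fin n → M → ℝ) (L : ℝ) (_ : 0 < L) (_ : ∀ i, RMarina.IsGSmooth d L (f i))
        (fstar : ℝ) (_ : ∀ x, fstar ≤ RMarina.objective f x) (x0 : M)
        -- the compressors
        (S : Type*) [MeasurableSpace S] (ν : Measure S) [IsProbabilityMeasure ν]
        (Q : Fin n → S → ∀ x : M, TangentSpace (𝓡 d) x → TangentSpace (𝓡 d) x)
        (ωQ : ℝ) (_ : ∀ i, RMarina.IsUnbiasedCompressor ν ωQ (Q i))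
        (b : RMarina.MeasurableFrame d M)
        -- the parameters of the method
        (ρ : ℝ) (_ : ρ = RMarina.expectedDensity b ν Q)
        (p : unitInterval) (_ : (p : ℝ) = ρ / d)
        (η : ℝ) (_ : η = 1 / (L * (1 + √((1 - p) / p * (ωQ / n)))))
        (ε : ℝ) (_ : 0 < ε),
        (∃ K₀ : ℕ, 1 ≤ K₀ ∧
          (K₀ : ℝ) ≤ max 1 (C * ((RMarina.objective f x0 - fstar) * L / ε ^ 2
            * (1 + √(ωQ / n * (d / ρ - 1))))) ∧
          ∀ K : ℕ, K₀ ≤ K →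
            RMarina.expectedSqGrad f Q η x0 p ν K ≤ ENNReal.ofReal (ε ^ 2)) ∧
        ∀ (K : ℕ) (i : Fin n),
          ∫⁻ r, (RMarina.commCost b f Q η x0 i r : ℝ≥0∞) ∂(RMarina.runLaw p ν n K)
            ≤ ENNReal.ofReal (C * (d + ρ * K)) := by

  -- `4` is the `2` of `2 / η` times the `2` lost in rounding; the cost bound needs only `2`.
  refine ⟨4, by norm_num, ?_⟩
  intro d n hd hn M _ _ _ _ _ _ _ hM f L hL hf fstar hstar x0 S _ ν _ Q ωQ hQ b ρ hρ p hp η hη ε hε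
  have hρ0 : 0 < ρ := hρ ▸ RMarina.expectedDensity_pos hd hn b Q hQ x0
  have hdR : (0 : ℝ) < d := by exact_mod_cast hd
  have hp0 : 0 < (p : ℝ) := by rw [hp]; positivity
  have hω : 0 ≤ ωQ := (hQ ⟨0, hn⟩).nonneg
  have hδ : 0 ≤ RMarina.objective f x0 - fstar := by linarith [hstar x0]
  refine ⟨?_, fun K i => ?_⟩
  · set B := √(ωQ / n * (d / ρ - 1)) with hB
    -- With `p = ρ / d`, the ratio `(1 - p) / p` equals `d / ρ - 1`.
    have hBη : √((1 - p) / p * (ωQ / n)) = B := by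
      rw [hB, hp, mul_comm]
      congr 2
      field_simp
    have hB0 : 0 ≤ B := Real.sqrt_nonneg _
    have h2η : 2 / η = 2 * (L * (1 + B)) := by
      rw [hη, hBη]; field_simp
    obtain ⟨K₀, h1, h2, h3⟩ := RMarina.exists_nat_rounds
      (2 * ((RMarina.objective f x0 - fstar) * L / ε ^ 2 * (1 + B)))
    refine ⟨K₀, h1, h2.trans_eq (by ring_nf), fun K hK => ?_⟩
    have hK0 : (0 : ℝ) < K := by exact_mod_cast h1.trans hK
    refine (RMarina.expectedSqGrad_le hM hn hL hf hstar hQ p hp0 hη x0 K).trans ?_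
    rw [← ENNReal.ofReal_natCast K, ← ENNReal.ofReal_inv_of_pos hK0,
      ← ENNReal.ofReal_mul (by positivity)]
    refine ENNReal.ofReal_le_ofReal ?_
    have h4 : 2 * ((RMarina.objective f x0 - fstar) * L / ε ^ 2 * (1 + B)) ≤ K :=
      h3.trans (by exact_mod_cast hK)
    rw [h2η, inv_mul_le_iff₀ hK0]
    calc 2 * (L * (1 + B)) * (RMarina.objective f x0 - fstar)
        = 2 * ((RMarina.objective f x0 - fstar) * L / ε ^ 2 * (1 + B)) * ε ^ 2 := by field_simp
      _ ≤ K * ε ^ 2 := by gcongr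
  · refine (RMarina.lintegral_commCost_le hd b p (hρ ▸ hp) x0 K i).trans ?_
    rw [← hρ, ← ENNReal.ofReal_natCast d, ← ENNReal.ofReal_natCast K,
      ← ENNReal.ofReal_mul (by positivity), ← ENNReal.ofReal_add (by positivity) (by positivity)]
    refine ENNReal.ofReal_le_ofReal ?_
    nlinarith [mul_nonneg hρ0.le (Nat.cast_nonneg (α := ℝ) K)]
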